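/- A polyhedron in $\mathbb{R}^r$ is an intersection of finitely many closed half-spaces, and $\mathbb{L}_\sigma\subset\mathbb{R}^r$ denotes the linear subspace parallel to the affine space spanned by a polyhedron $\sigma$. A polyhedral complex $\mathcal{C}$ in $\mathbb{R}^r$ is a finite set of polyhedra that contains all nonempty faces of its members and in which any two members intersect in a common (possibly empty) face; its support $|\mathcal{C}|$ is the union of its members. A superform of bidegree $(p,q)$ on an open set $V\subset\mathbb{R}^r$ is an element of $A^{p,q}(V)=A^p(V)\otimes_{\mathbb{R}}\Lambda^q(\mathbb{R}^r)^*=\Lambda^p(\mathbb{R}^r)^*\otimes_{\mathbb{R}}A^q(V)$, where $A^p(V)$ is the space of smooth real $p$-forms on $V$. With $D$ the exterior derivative, put $d'=D\otimes\mathrm{id}\colon A^{p,q}(V)\to A^{p+1,q}(V)$, $d''=(-1)^p\,\mathrm{id}\otimes D\colon A^{p,q}(V)\to A^{p,q+1}(V)$ and $d=d'+d''$. For an open subset $\Omega$ of $|\mathcal{C}|$, a superform in $A^{p,q}(\Omega)$ is given by a superform $\alpha'\in A^{p,q}(V)$ on some open $V\subset\mathbb{R}^r$ with $V\cap|\mathcal{C}|=\Omega$,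 where $\alpha'$ and $\alpha''$ give the same element if $$\langle\alpha'(x);v_1,\dots,v_p,w_1,\dots,w_q\rangle=\langle\alpha''(x);v_1,\dots,v_p,w_1,\dots,w_q\rangle$$ for all $\sigma\in\mathcal{C}$, $x\in\sigma\cap\Omega$ and $v_i,w_j\in\mathbb{L}_\sigma$. The operators $d'$, $d''$ and $d$ pass to these spaces. Put $A^k(\Omega)=\bigoplus_{p+q=k}A^{p,q}(\Omega)$, and let $H^k_d(\Omega)$ be the $k$-th cohomology of the complex $(A^\bullet(\Omega),d)$. Theorem. For every polyhedral complex $\mathcal{C}$ in $\mathbb{R}^r$ and every $k\in\mathbb{N}_0$, the real vector space $H^k_d(|\mathcal{C}|)$ is finite dimensional. -/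

import Mathlib

set_option maxSynthPendingDepth 3

open scoped ContDiff
open TopologicalSpace (Opens)

namespace Superform

/-! ### Polyhedral complexes -/

section Polyhedra

variable (E : Type*) [NormedAddCommGroup E] [NormedSpace ℝ E]

variable {E} in
/-- A (convex) polyhedron: an intersection of finitely many closed half-spaces. -/
def IsPolyhedron (σ : Set E) : Prop :=
  ∃ H : Finset ((E →L[ℝ] ℝ) × ℝ), σ = {x | ∀ h ∈ H, h.1 x ≤ h.2}

/-- A polyhedral complex: a finite set of polyhedra, containing the faces of its members and such
that any two members intersect in a common face. The faces of a polyhedron are its exposed subsets: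
the polyhedron itself, its intersections with supporting hyperplanes, and the empty set. A complex
may, but need not, list the empty face among its members. -/
structure PolyhedralComplex where
  /-- The polyhedra of the complex. -/
  cells : Set (Set E)
  finite_cells : cells.Finite
  isPolyhedron_of_mem : ∀ σ ∈ cells, IsPolyhedron σ
  face_mem : ∀ σ ∈ cells, ∀ τ : Set E, IsExposed ℝ σ τ → τ.Nonempty → τ ∈ cells
  inter_isFace : ∀ σ ∈ cells, ∀ τ ∈ cells, IsExposed ℝ σ (σ ∩ τ) ∧ IsExposed ℝ τ (σ ∩ τ)

variable {E} in
/-- The support `|C|`: the union of all polyhedra of the complex, with the subspace topology. -/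
def PolyhedralComplex.support (C : PolyhedralComplex E) : Set E := ⋃₀ C.cells

end Polyhedra

variable {E : Type*} [NormedAddCommGroup E] [NormedSpace ℝ E]

/-! ### Superforms on open subsets of a vector space, and the operators `d'` and `d''` -/

variable (E) in
/-- `Λ^p E* ⊗ Λ^q E*`, as alternating `p`-forms with values in alternating `q`-forms.
A superform of bidegree `(p, q)` on an open `V ⊆ E` is a smooth map from `V` to this space, and
`α x v w` is its value `⟨α(x); v₁, …, v_p, w₁, …, w_q⟩`. -/
abbrev Cov (p q : ℕ) : Type _ := E [⋀^Fin p]→L[ℝ] (E [⋀^Fin q]→L[ℝ] ℝ)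

/-- `d' = D ⊗ id`, the exterior derivative of `α` as a `p`-form with values in `Λ^q E*`. -/
noncomputable def dPrimeFun {p q : ℕ} (α : E → Cov E p q) : E → Cov E (p + 1) q :=
  extDeriv α

/-- The operator `(-1)^p id ⊗ D` on first-order jets; see `dDoublePrimeFun`. -/
noncomputable def altSecond (p q : ℕ) : (E →L[ℝ] Cov E p q) →L[ℝ] Cov E p (q + 1) :=
  LinearMap.mkContinuous
    { toFun := fun L => (-1 : ℝ) ^ p •
        (ContinuousAlternatingMap.alternatizeUncurryFinCLM ℝ E ℝ
          (n := q)).compContinuousAlternatingMap L.flipAlternating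
      map_add' := fun L M => by
        ext v w
        simp [ContinuousAlternatingMap.alternatizeUncurryFin_apply, Finset.sum_add_distrib, mul_add]
      map_smul' := fun c L => by
        ext v w
        simp [ContinuousAlternatingMap.alternatizeUncurryFin_apply, Finset.mul_sum,
          mul_left_comm] }
    (q + 1) (fun L => by
      simp only [LinearMap.coe_mk, AddHom.coe_mk, norm_smul, norm_pow, norm_neg, norm_one, one_pow,
        one_mul]
      refine (ContinuousLinearMap.norm_compContinuousAlternatingMap_le _ _).trans ?_
      gcongr
      · exact ContinuousAlternatingMap.norm_alternatizeUncurryFinCLM_le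
      · refine ContinuousAlternatingMap.opNorm_le_bound _ (norm_nonneg _) fun v => ?_
        refine ContinuousLinearMap.opNorm_le_bound _ (by positivity) fun x => ?_
        rw [ContinuousLinearMap.flipAlternating_apply_apply]
        refine ((L x).le_opNorm v).trans ?_
        have := L.le_opNorm x
        calc ‖L x‖ * ∏ i, ‖v i‖ ≤ (‖L‖ * ‖x‖) * ∏ i, ‖v i‖ := by gcongr
          _ = _ := by ring)

/-- `d'' = (-1)^p id ⊗ D`: up to the sign `(-1)^p`, the exterior derivative in the second factor
(see `dDoublePrimeFun_apply`). -/
noncomputable def dDoublePrimeFun {p q : ℕ} (α : E → Cov E p q) (x : E) : Cov E p (q + 1) :=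
  altSecond p q (fderiv ℝ α x)

theorem altSecond_apply {p q : ℕ} (L : E →L[ℝ] Cov E p q) (v : Fin p → E) (w : Fin (q + 1) → E) :
    altSecond p q L v w =
      (-1 : ℝ) ^ p * ∑ j : Fin (q + 1), (-1) ^ (j : ℕ) • L (w j) v (j.removeNth w) := by
  simp [altSecond, ContinuousAlternatingMap.alternatizeUncurryFin_apply]

theorem dDoublePrimeFun_apply {p q : ℕ} {α : E → Cov E p q} {x : E} (hα : DifferentiableAt ℝ α x)
    (v : Fin p → E) :
    dDoublePrimeFun α x v = (-1 : ℝ) ^ p • extDeriv (fun y => α y v) x := by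
  ext w
  rw [dDoublePrimeFun, altSecond_apply, extDeriv,
    fderiv_continuousAlternatingMap_apply_const hα]
  simp [ContinuousAlternatingMap.alternatizeUncurryFin_apply]

theorem hasFDerivAt_op {p q p' q' : ℕ} (Φ : (E →L[ℝ] Cov E p q) →L[ℝ] Cov E p' q')
    {α : E → Cov E p q} {x : E} (hα : ContDiffAt ℝ ∞ α x) :
    HasFDerivAt (fun y => Φ (fderiv ℝ α y)) (Φ ∘L fderiv ℝ (fderiv ℝ α) x) x := by
  have h : ContDiffAt ℝ 1 (fderiv ℝ α) x := hα.fderiv_right (by norm_cast)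
  exact Φ.hasFDerivAt.comp x (h.differentiableAt one_ne_zero).hasFDerivAt

theorem dPrimeFun_dPrimeFun {p q : ℕ} {α : E → Cov E p q} {x : E} (hα : ContDiffAt ℝ ∞ α x) :
    dPrimeFun (dPrimeFun α) x = 0 :=
  extDeriv_extDeriv_apply hα (by simp [minSmoothness_of_isRCLikeNormedField]; norm_cast)

theorem dDoublePrimeFun_dDoublePrimeFun {p q : ℕ} {α : E → Cov E p q} {x : E}
    (hα : ContDiffAt ℝ ∞ α x) : dDoublePrimeFun (dDoublePrimeFun α) x = 0 := by
  ext1 v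
  have hd : DifferentiableAt ℝ (dDoublePrimeFun α) x :=
    (hasFDerivAt_op (altSecond p q) hα).differentiableAt
  rw [dDoublePrimeFun_apply hd]
  have hev : ∀ᶠ y in nhds x, DifferentiableAt ℝ α y := by
    filter_upwards [(hα.of_le (m := 1) (by norm_cast)).eventually (by simp)] with y hy
    exact hy.differentiableAt one_ne_zero
  have h1 : (fun y => dDoublePrimeFun α y v) =ᶠ[nhds x]
      ((-1 : ℝ) ^ p • extDeriv (fun y => α y v)) := by
    filter_upwards [hev] with y hy
    rw [dDoublePrimeFun_apply hy]; rfl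
  have h2 : ContDiffAt ℝ ∞ (fun y => α y v) x :=
    (ContinuousAlternatingMap.apply ℝ E (E [⋀^Fin q]→L[ℝ] ℝ) v).contDiff.contDiffAt.comp x hα
  rw [h1.extDeriv_eq, extDeriv_smul, extDeriv_extDeriv_apply h2
    (by simp [minSmoothness_of_isRCLikeNormedField]; norm_cast)]
  simp

theorem dPrimeFun_dDoublePrimeFun {p q : ℕ} {α : E → Cov E p q} {x : E}
    (hα : ContDiffAt ℝ ∞ α x) :
    dPrimeFun (dDoublePrimeFun α) x + dDoublePrimeFun (dPrimeFun α) x = 0 := by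
  have hs : IsSymmSndFDerivAt ℝ α x :=
    hα.isSymmSndFDerivAt (by simp [minSmoothness_of_isRCLikeNormedField]; norm_cast)
  ext v w
  have h1 : fderiv ℝ (dDoublePrimeFun α) x = _ := (hasFDerivAt_op (altSecond p q) hα).fderiv
  have h2 : fderiv ℝ (dPrimeFun α) x = _ := (hasFDerivAt_op
    (ContinuousAlternatingMap.alternatizeUncurryFinCLM ℝ E (E [⋀^Fin q]→L[ℝ] ℝ) (n := p)) hα).fderiv
  rw [dDoublePrimeFun, h2, dPrimeFun, extDeriv, h1, ContinuousAlternatingMap.add_apply,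
    ContinuousAlternatingMap.add_apply, altSecond_apply]
  simp only [ContinuousAlternatingMap.alternatizeUncurryFin_apply,
    ContinuousAlternatingMap.sum_apply, ContinuousAlternatingMap.smul_apply,
    ContinuousLinearMap.comp_apply, altSecond_apply,
    ContinuousAlternatingMap.alternatizeUncurryFinCLM_apply]
  change _ = (0 : ℝ)
  simp only [Finset.smul_sum, Finset.mul_sum]
  rw [Finset.sum_comm (s := (Finset.univ : Finset (Fin (q+1)))), ← Finset.sum_add_distrib]
  refine Finset.sum_eq_zero fun i _ => ?_
  rw [← Finset.sum_add_distrib]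
  refine Finset.sum_eq_zero fun j _ => ?_
  rw [hs (v i) (w j)]
  simp only [zsmul_eq_mul]
  push_cast
  ring

/-! ### Superforms on open subsets of the support of a polyhedral complex -/

section Complex

variable {C : PolyhedralComplex E} (Ω : Opens C.support)

/-- The superforms of bidegree `(p, q)` given on some open `V ⊆ E` with `V ∩ |C| = Ω`. They are
functions on `E` of which only the restriction to `V` is constrained. -/
def presentation (p q : ℕ) : Submodule ℝ (E → Cov E p q) where
  carrier := {α | ∃ V : Set E, IsOpen V ∧ ((↑) : C.support → E) ⁻¹' V = Ω ∧ ContDiffOn ℝ ∞ α V}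
  add_mem' := by
    rintro α β ⟨V, hV, hVΩ, hα⟩ ⟨W, hW, hWΩ, hβ⟩
    exact ⟨V ∩ W, hV.inter hW, by rw [Set.preimage_inter, hVΩ, hWΩ, Set.inter_self],
      (hα.mono Set.inter_subset_left).add (hβ.mono Set.inter_subset_right)⟩
  zero_mem' := by
    obtain ⟨V, hV, hVΩ⟩ := isOpen_induced_iff.1 Ω.isOpen
    exact ⟨V, hV, hVΩ, contDiffOn_const⟩
  smul_mem' := by
    rintro c α ⟨V, hV, hVΩ, hα⟩
    exact ⟨V, hV, hVΩ, hα.const_smul c⟩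

/-- `α` restricts to zero on `σ ∩ Ω` for each polyhedron `σ` of the complex: it vanishes at the
points of `σ ∩ Ω` on tangent vectors in the linear space `vectorSpan ℝ σ` parallel to `σ`. -/
def RestrictsToZero {p q : ℕ} (α : E → Cov E p q) : Prop :=
  ∀ σ ∈ C.cells, ∀ x ∈ Ω, (x : E) ∈ σ →
    ∀ v : Fin p → E, (∀ i, v i ∈ vectorSpan ℝ σ) →
    ∀ w : Fin q → E, (∀ j, w j ∈ vectorSpan ℝ σ) → α x v w = 0

/-- The presentations of the zero superform on `Ω`. -/
def nullForms (p q : ℕ) : Submodule ℝ (presentation Ω p q) where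
  carrier := {α | RestrictsToZero Ω α.1}
  add_mem' := fun {α β} hα hβ σ hσ x hx hxσ v hv w hw => by
    have h1 := hα σ hσ x hx hxσ v hv w hw
    have h2 := hβ σ hσ x hx hxσ v hv w hw
    simp [h1, h2]
  zero_mem' := fun σ hσ x hx hxσ v hv w hw => by simp
  smul_mem' := fun c α hα σ hσ x hx hxσ v hv w hw => by
    have h1 := hα σ hσ x hx hxσ v hv w hw
    simp [h1]

/-- `A^{p,q}(Ω)`: superforms of bidegree `(p, q)` on `Ω`, given by superforms on open `V ⊆ E` with
`V ∩ |C| = Ω`; two of these define the same element iff their restrictions to `σ ∩ Ω` agree for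
every polyhedron `σ` of the complex. -/
def Form (p q : ℕ) : Type _ := presentation Ω p q ⧸ nullForms Ω p q

noncomputable instance (p q : ℕ) : AddCommGroup (Form Ω p q) :=
  inferInstanceAs (AddCommGroup (presentation Ω p q ⧸ nullForms Ω p q))

noncomputable instance (p q : ℕ) : Module ℝ (Form Ω p q) :=
  inferInstanceAs (Module ℝ (presentation Ω p q ⧸ nullForms Ω p q))

variable {Ω} in
/-- The superform on `Ω` given by a superform on an open `V ⊆ E` with `V ∩ |C| = Ω`. -/
noncomputable def Form.mk {p q : ℕ} : presentation Ω p q →ₗ[ℝ] Form Ω p q :=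
  (nullForms Ω p q).mkQ

variable {Ω} in
theorem Form.mk_eq_zero_iff {p q : ℕ} (α : presentation Ω p q) :
    Form.mk α = 0 ↔ RestrictsToZero Ω α.1 :=
  Submodule.Quotient.mk_eq_zero (nullForms Ω p q)

variable {Ω} in
theorem presentation_contDiffAt {p q : ℕ} {α : E → Cov E p q} (hα : α ∈ presentation Ω p q)
    {x : C.support} (hx : x ∈ Ω) : ContDiffAt ℝ ∞ α x := by
  obtain ⟨V, hV, hVΩ, h⟩ := hα
  refine h.contDiffAt (hV.mem_nhds ?_)
  have : x ∈ ((↑) : C.support → E) ⁻¹' V := by rw [hVΩ]; exact hx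
  exact this

/-- Applying a linear operator to the first derivative of a superform gives a superform. -/
theorem op_mem_presentation {p q p' q' : ℕ} (Φ : (E →L[ℝ] Cov E p q) →L[ℝ] Cov E p' q')
    {α : E → Cov E p q} (hα : α ∈ presentation Ω p q) :
    (fun x => Φ (fderiv ℝ α x)) ∈ presentation Ω p' q' := by
  obtain ⟨V, hV, hVΩ, h⟩ := hα
  exact ⟨V, hV, hVΩ, Φ.contDiff.comp_contDiffOn (h.fderiv_of_isOpen hV (m := ∞) (by simp))⟩

/-- If a superform restricts to zero on `σ`, so do its derivatives in directions tangent to `σ`. -/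
theorem fderiv_eq_zero_of_restrictsToZero {p q : ℕ} {α : E → Cov E p q}
    (hα : α ∈ presentation Ω p q) (h0 : RestrictsToZero Ω α) {σ : Set E} (hσ : σ ∈ C.cells)
    {x : C.support} (hx : x ∈ Ω) (hxσ : (x : E) ∈ σ) {u : E} (hu : u ∈ vectorSpan ℝ σ)
    {v : Fin p → E} (hv : ∀ i, v i ∈ vectorSpan ℝ σ)
    {w : Fin q → E} (hw : ∀ j, w j ∈ vectorSpan ℝ σ) : fderiv ℝ α x u v w = 0 := by
  have hd : DifferentiableAt ℝ α x := (presentation_contDiffAt hα hx).differentiableAt (by simp)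
  obtain ⟨V, hV, hVΩ, -⟩ := hα
  have hxV : (x : E) ∈ V := by
    have : x ∈ ((↑) : C.support → E) ⁻¹' V := by rw [hVΩ]; exact hx
    exact this
  have hconv : Convex ℝ σ := by
    obtain ⟨H, rfl⟩ := C.isPolyhedron_of_mem σ hσ
    intro a ha b hb s t hs ht hst h hh
    have h1 := ha h hh
    have h2 := hb h hh
    simp only [map_add, map_smul, smul_eq_mul]
    calc s * h.1 a + t * h.1 b ≤ s * h.2 + t * h.2 := by gcongr
      _ = h.2 := by rw [← add_mul, hst, one_mul]
  set g : E → ℝ := fun y => α y v w with hg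
  have hgd : HasFDerivAt g ((((fderiv ℝ α x).flipAlternating v)).flipAlternating w) x :=
    (hd.hasFDerivAt.continuousAlternatingMap_apply_const v).continuousAlternatingMap_apply_const w
  suffices H : ∀ u ∈ vectorSpan ℝ σ, (((fderiv ℝ α x).flipAlternating v)).flipAlternating w u = 0 by
    simpa using H u hu
  rw [vectorSpan_eq_span_vsub_set_right ℝ hxσ]
  intro u hu
  induction hu using Submodule.span_induction with
  | zero => simp
  | add a b _ _ ha hb => simp only [map_add, ha, hb, add_zero]
  | smul c a _ ha => simp only [map_smul, ha, smul_zero]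
  | mem u hu =>
    obtain ⟨y, hy, rfl⟩ := hu
    simp only [vsub_eq_sub]
    have hline : HasDerivAt (fun t : ℝ => (x : E) + t • (y - x)) (y - (x : E)) 0 := by
      simpa using ((hasDerivAt_id (0 : ℝ)).smul_const (y - (x : E))).const_add (x : E)
    have hgd' : HasFDerivAt g ((((fderiv ℝ α x).flipAlternating v)).flipAlternating w)
        ((x : E) + (0 : ℝ) • (y - x)) := by simpa using hgd
    have hcomp := hgd'.comp_hasDerivAt (0 : ℝ) hline
    have hzero : HasDerivWithinAt (g ∘ fun t : ℝ => (x : E) + t • (y - x)) 0 (Set.Ici 0) 0 := by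
      refine (hasDerivWithinAt_const (0 : ℝ) (Set.Ici 0) (0 : ℝ)).congr_of_eventuallyEq ?_ ?_
      · have hcont : ContinuousAt (fun t : ℝ => (x : E) + t • (y - x)) 0 := hline.continuousAt
        have hVt : ∀ᶠ t : ℝ in nhds 0, (x : E) + t • (y - x) ∈ V :=
          hcont.eventually (hV.mem_nhds (by simpa using hxV))
        filter_upwards [nhdsWithin_le_nhds hVt, self_mem_nhdsWithin,
          nhdsWithin_le_nhds (Iic_mem_nhds (zero_lt_one (α := ℝ)))] with t ht h0t ht1
        have hmem : (x : E) + t • (y - x) ∈ σ := by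
          have := hconv.add_smul_sub_mem hxσ hy ⟨h0t, ht1⟩
          exact this
        have hsupp : (x : E) + t • (y - x) ∈ C.support := ⟨σ, hσ, hmem⟩
        have hΩ : (⟨_, hsupp⟩ : C.support) ∈ Ω := by
          have : (⟨_, hsupp⟩ : C.support) ∈ ((↑) : C.support → E) ⁻¹' V := ht
          rw [hVΩ] at this
          exact this
        exact h0 σ hσ ⟨_, hsupp⟩ hΩ hmem v hv w hw
      · have := h0 σ hσ x hx hxσ v hv w hw
        simpa [g] using this
    exact (uniqueDiffWithinAt_Ici (0 : ℝ)).eq_deriv _ hcomp.hasDerivWithinAt hzero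

/-- The operator on superforms on `Ω` induced by a linear operator on first derivatives which is
compatible with the restriction to linear subspaces. -/
noncomputable def Form.op {p q p' q' : ℕ} (Φ : (E →L[ℝ] Cov E p q) →L[ℝ] Cov E p' q')
    (hΦ : ∀ (S : Submodule ℝ E) (L : E →L[ℝ] Cov E p q),
      (∀ u ∈ S, ∀ v : Fin p → E, (∀ i, v i ∈ S) → ∀ w : Fin q → E, (∀ j, w j ∈ S) → L u v w = 0) →
      ∀ v : Fin p' → E, (∀ i, v i ∈ S) → ∀ w : Fin q' → E, (∀ j, w j ∈ S) → Φ L v w = 0) :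
    Form Ω p q →ₗ[ℝ] Form Ω p' q' :=
  (nullForms Ω p q).liftQ
    { toFun := fun α => Form.mk
        ⟨fun x => Φ (fderiv ℝ α.1 x), op_mem_presentation Ω Φ α.2⟩
      map_add' := fun α β => by
        rw [← map_add, ← sub_eq_zero, ← map_sub, Form.mk_eq_zero_iff]
        intro σ hσ x hx hxσ v hv w hw
        have h1 := (presentation_contDiffAt α.2 hx).differentiableAt (by simp)
        have h2 := (presentation_contDiffAt β.2 hx).differentiableAt (by simp)
        simp [fderiv_add h1 h2]
      map_smul' := fun c α => by
        rw [RingHom.id_apply, ← map_smul, ← sub_eq_zero, ← map_sub, Form.mk_eq_zero_iff]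
        intro σ hσ x hx hxσ v hv w hw
        have h1 := (presentation_contDiffAt α.2 hx).differentiableAt (by simp)
        simp [fderiv_const_smul h1 c] }
    (fun α hα => by
      rw [LinearMap.mem_ker, LinearMap.coe_mk, AddHom.coe_mk, Form.mk_eq_zero_iff]
      intro σ hσ x hx hxσ v hv w hw
      exact hΦ (vectorSpan ℝ σ) _ (fun u hu v hv w hw =>
        fderiv_eq_zero_of_restrictsToZero Ω α.2 hα hσ hx hxσ hu hv hw) v hv w hw)

/-- `d' : A^{p,q}(Ω) → A^{p+1,q}(Ω)`, induced by `dPrimeFun`. -/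
noncomputable def Form.dPrime (p q : ℕ) : Form Ω p q →ₗ[ℝ] Form Ω (p + 1) q :=
  Form.op Ω (ContinuousAlternatingMap.alternatizeUncurryFinCLM ℝ E (E [⋀^Fin q]→L[ℝ] ℝ) (n := p))
    (fun S L hL v hv w hw => by
      rw [ContinuousAlternatingMap.alternatizeUncurryFinCLM_apply,
        ContinuousAlternatingMap.alternatizeUncurryFin_apply, ContinuousAlternatingMap.sum_apply]
      refine Finset.sum_eq_zero fun i _ => ?_
      rw [ContinuousAlternatingMap.smul_apply,
        hL _ (hv i) (i.removeNth v) (fun j => hv (i.succAbove j)) w hw, smul_zero])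

/-- `d'' : A^{p,q}(Ω) → A^{p,q+1}(Ω)`, induced by `dDoublePrimeFun`. -/
noncomputable def Form.dDoublePrime (p q : ℕ) : Form Ω p q →ₗ[ℝ] Form Ω p (q + 1) :=
  Form.op Ω (altSecond p q)
    (fun S L hL v hv w hw => by
      rw [altSecond_apply]
      rw [Finset.sum_eq_zero, mul_zero]
      intro j _
      rw [hL _ (hw j) v hv (j.removeNth w) (fun i => hw (j.succAbove i)), smul_zero])

/-- `d'` of the form given by `α` is given by `d'α`. -/
theorem Form.dPrime_mk (p q : ℕ) (α : presentation Ω p q) :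
    Form.dPrime Ω p q (Form.mk α) =
      Form.mk ⟨dPrimeFun α.1, op_mem_presentation Ω _ α.2⟩ := rfl

/-- `d''` of the form given by `α` is given by `d''α`. -/
theorem Form.dDoublePrime_mk (p q : ℕ) (α : presentation Ω p q) :
    Form.dDoublePrime Ω p q (Form.mk α) =
      Form.mk ⟨dDoublePrimeFun α.1, op_mem_presentation Ω _ α.2⟩ := rfl

theorem Form.dPrime_dPrime (p q : ℕ) (a : Form Ω p q) :
    Form.dPrime Ω (p + 1) q (Form.dPrime Ω p q a) = 0 := by
  obtain ⟨α, rfl⟩ := Submodule.mkQ_surjective (nullForms Ω p q) a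
  change Form.dPrime Ω (p + 1) q (Form.dPrime Ω p q (Form.mk α)) = 0
  rw [Form.dPrime_mk, Form.dPrime_mk, Form.mk_eq_zero_iff]
  intro σ _ x hx _ v _ w _
  simp [dPrimeFun_dPrimeFun (presentation_contDiffAt α.2 hx)]

theorem Form.dDoublePrime_dDoublePrime (p q : ℕ) (a : Form Ω p q) :
    Form.dDoublePrime Ω p (q + 1) (Form.dDoublePrime Ω p q a) = 0 := by
  obtain ⟨α, rfl⟩ := Submodule.mkQ_surjective (nullForms Ω p q) a
  change Form.dDoublePrime Ω p (q + 1) (Form.dDoublePrime Ω p q (Form.mk α)) = 0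
  rw [Form.dDoublePrime_mk, Form.dDoublePrime_mk, Form.mk_eq_zero_iff]
  intro σ _ x hx _ v _ w _
  simp [dDoublePrimeFun_dDoublePrimeFun (presentation_contDiffAt α.2 hx)]

theorem Form.dPrime_dDoublePrime (p q : ℕ) (a : Form Ω p q) :
    Form.dPrime Ω p (q + 1) (Form.dDoublePrime Ω p q a) +
      Form.dDoublePrime Ω (p + 1) q (Form.dPrime Ω p q a) = 0 := by
  obtain ⟨α, rfl⟩ := Submodule.mkQ_surjective (nullForms Ω p q) a
  change Form.dPrime Ω p (q + 1) (Form.dDoublePrime Ω p q (Form.mk α)) +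
      Form.dDoublePrime Ω (p + 1) q (Form.dPrime Ω p q (Form.mk α)) = 0
  rw [Form.dPrime_mk, Form.dDoublePrime_mk, Form.dPrime_mk, Form.dDoublePrime_mk, ← map_add,
    Form.mk_eq_zero_iff]
  intro σ _ x hx _ v _ w _
  change (dPrimeFun (dDoublePrimeFun α.1) x + dDoublePrimeFun (dPrimeFun α.1) x) v w = 0
  rw [dPrimeFun_dDoublePrimeFun (presentation_contDiffAt α.2 hx)]
  simp

/-- `A^k(Ω) = ⨁_{p+q=k} A^{p,q}(Ω)`, a finite direct sum. -/
abbrev TotalForm (k : ℕ) : Type _ :=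
  ∀ i : {i : ℕ × ℕ // i.1 + i.2 = k}, Form Ω i.1.1 i.1.2

/-- The projection of `A^k(Ω)` onto its summand `A^{p,q}(Ω)`, where `p + q = k`. -/
noncomputable def TotalForm.component (k p q : ℕ) (h : p + q = k) :
    TotalForm Ω k →ₗ[ℝ] Form Ω p q :=
  LinearMap.proj (R := ℝ) (φ := fun i : {i : ℕ × ℕ // i.1 + i.2 = k} => Form Ω i.1.1 i.1.2)
    ⟨(p, q), h⟩

/-- The component in `A^{p,q}(Ω)`, with `p + q = k + 1`, of the differential `d = d' + d''`: the sum
of `d'` of the component of bidegree `(p-1, q)` and `d''` of the component of bidegree `(p, q-1)`,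
a component being absent when `p = 0` or `q = 0`. -/
noncomputable def TotalForm.dComponent (k : ℕ) :
    (p q : ℕ) → p + q = k + 1 → (TotalForm Ω k →ₗ[ℝ] Form Ω p q)
  | 0, 0, h => absurd h (by omega)
  | p + 1, 0, h => Form.dPrime Ω p 0 ∘ₗ component Ω k _ _ (by omega)
  | 0, q + 1, h => Form.dDoublePrime Ω 0 q ∘ₗ component Ω k _ _ (by omega)
  | p + 1, q + 1, h =>
      Form.dPrime Ω p (q + 1) ∘ₗ component Ω k _ _ (by omega) +
        Form.dDoublePrime Ω (p + 1) q ∘ₗ component Ω k _ _ (by omega)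

/-- The differential `d = d' + d'' : A^k(Ω) → A^{k+1}(Ω)`. -/
noncomputable def TotalForm.d (k : ℕ) : TotalForm Ω k →ₗ[ℝ] TotalForm Ω (k + 1) :=
  LinearMap.pi fun i => TotalForm.dComponent Ω k i.1.1 i.1.2 i.2

/-- `d ∘ d = 0`. -/
theorem TotalForm.d_comp_d (k : ℕ) (a : TotalForm Ω k) :
    TotalForm.d Ω (k + 1) (TotalForm.d Ω k a) = 0 := by
  have key : ∀ p q h, component Ω (k + 1) p q h (TotalForm.d Ω k a) = dComponent Ω k p q h a :=
    fun _ _ _ => rfl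
  funext ⟨⟨p, q⟩, h⟩
  change dComponent Ω (k + 1) p q h (TotalForm.d Ω k a) = 0
  match p, q, h with
  | 0, 0, h => exact absurd h (by omega)
  | 1, 0, h => exact absurd h (by omega)
  | 0, 1, h => exact absurd h (by omega)
  | p + 2, 0, h => simp [dComponent, key, Form.dPrime_dPrime]
  | 0, q + 2, h => simp [dComponent, key, Form.dDoublePrime_dDoublePrime]
  | 1, 1, h => simp [dComponent, key, Form.dPrime_dDoublePrime]
  | p + 2, 1, h =>
    simp only [dComponent, key, LinearMap.add_apply, LinearMap.comp_apply, map_add,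
      Form.dPrime_dPrime, zero_add]
    exact Form.dPrime_dDoublePrime _ _ _ _
  | 1, q + 2, h =>
    simp only [dComponent, key, LinearMap.add_apply, LinearMap.comp_apply, map_add,
      Form.dDoublePrime_dDoublePrime, add_zero]
    exact Form.dPrime_dDoublePrime _ _ _ _
  | p + 2, q + 2, h =>
    simp only [dComponent, key, LinearMap.add_apply, LinearMap.comp_apply, map_add,
      Form.dPrime_dPrime, Form.dDoublePrime_dDoublePrime, zero_add, add_zero]
    exact Form.dPrime_dDoublePrime _ _ _ _

/-- The `d`-exact superforms of degree `k`. -/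
noncomputable def exactForms : (k : ℕ) → Submodule ℝ (TotalForm Ω k)
  | 0 => ⊥
  | k + 1 => LinearMap.range (TotalForm.d Ω k)

/-- `H^k_d(Ω)`: the `d`-closed superforms of degree `k` modulo the `d`-exact ones. -/
abbrev DCohomology (k : ℕ) : Type _ :=
  LinearMap.ker (TotalForm.d Ω k) ⧸ (exactForms Ω k).submoduleOf (LinearMap.ker (TotalForm.d Ω k))

end Complex

end Superform

/-!
The complex `(A^•(Ω), d)` is the total complex of the first-quadrant double complex
`(A^{p,q}(Ω), d', d'')`, so it suffices that `H^{p,q}_{d''}(|C|)` is finite dimensional for all `p`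
and `q`: filter the closed superforms by the first degree
(`FiniteDDoublePrimeCohomology.finiteModulo_d`).

For `d''` the support is covered by finitely many open stars. The open star of a point `x` consists
of the points all of whose cells contain `x`. Two properties make these sets a good cover. If two
open stars meet, their intersection is again an open star, centred at the midpoint of the two centres
(`openStar_inf_openStar`). And an open star is star-shaped about its centre, by segments that stay in
every cell containing their end point (`exists_mem_openStar_eq`, `segment_mem_of_mem_openStar`). Both
rest on the convexity of cells and on the fact that cells meet in common faces: a cell that meets the
interior of a segment in another cell contains that segment (`left_mem_of_mem_openSegment`).

On an open star the homotopy operator that contracts the second factor along the segments from the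
centre, and treats the first factor as coefficients, respects the restriction to cells. This gives
the Poincaré lemma: `H^{p,q}_{d''}` vanishes for `q > 0`, and `H^{p,0}_{d''}` consists of constant
superforms (`finiteDDoublePrimeCohomology_openStar`). Smooth cutoff functions give the
Mayer–Vietoris sequence for `d''` (`FiniteDDoublePrimeCohomology.sup`), and an induction on the
number of open stars passes to the whole support (`finiteDDoublePrimeCohomology_top`).
-/

namespace Superform

/-! ### Finiteness modulo a subspace -/

section LinearAlgebra

variable {M N : Type*} [AddCommGroup M] [Module ℝ M] [AddCommGroup N] [Module ℝ N]

/-- The image of `Z` in `M ⧸ B` is finite dimensional. For the cycles `Z` and the boundaries `B` of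
a complex this says that the cohomology `Z / B` is finite dimensional. -/
def FiniteModulo (Z B : Submodule ℝ M) : Prop :=
  ∃ W : Submodule ℝ M, W.FG ∧ Z ≤ W ⊔ B

theorem FiniteModulo.mono {Z Z' B B' : Submodule ℝ M} (h : FiniteModulo Z B) (hZ : Z' ≤ Z)
    (hB : B ≤ B') : FiniteModulo Z' B' := by
  obtain ⟨W, hW, hle⟩ := h
  exact ⟨W, hW, hZ.trans (hle.trans (sup_le_sup_left hB W))⟩

theorem finiteModulo_of_le {Z B : Submodule ℝ M} (h : Z ≤ B) : FiniteModulo Z B :=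
  ⟨⊥, Submodule.fg_bot, by simpa using h⟩

theorem FiniteModulo.sup {Z B : Submodule ℝ M} (h : FiniteModulo Z B) : FiniteModulo (Z ⊔ B) B := by
  obtain ⟨W, hW, hle⟩ := h
  exact ⟨W, hW, sup_le hle le_sup_right⟩

theorem FiniteModulo.prod {Z B : Submodule ℝ M} {Z' B' : Submodule ℝ N} (h : FiniteModulo Z B)
    (h' : FiniteModulo Z' B') : FiniteModulo (Z.prod Z') (B.prod B') := by
  obtain ⟨W, hW, hle⟩ := h
  obtain ⟨W', hW', hle'⟩ := h'
  refine ⟨W.prod W', hW.prod hW', ?_⟩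
  rw [Submodule.prod_sup_prod]
  exact Submodule.prod_mono hle hle'

/-- A linear map reduces finiteness modulo `B` to finiteness of the image modulo `B'` and finiteness
of the part of `Z` that is mapped into `B'`. -/
theorem FiniteModulo.of_map (f : M →ₗ[ℝ] N) {Z B : Submodule ℝ M} {B' : Submodule ℝ N}
    (h₁ : FiniteModulo (Z.map f) B') (h₂ : FiniteModulo (Z ⊓ B'.comap f) B) :
    FiniteModulo Z B := by
  obtain ⟨W₁, hW₁, hle₁⟩ := h₁
  obtain ⟨W₂, hW₂, hle₂⟩ := h₂
  have hfg : (Z.map (B'.mkQ ∘ₗ f)).FG := by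
    have : Z.map (B'.mkQ ∘ₗ f) ≤ W₁.map B'.mkQ := by
      rw [Submodule.map_comp]
      refine (Submodule.map_mono hle₁).trans ?_
      simp [Submodule.map_sup]
    exact Submodule.FG.of_le (hW₁.map _) this
  obtain ⟨s, hs, hspan⟩ := (Submodule.fg_def).1 hfg
  -- Lift a finite generating set of the image of `Z` in `N ⧸ B'` to `Z`.
  have hsub : s ⊆ (B'.mkQ ∘ₗ f) '' Z := by
    intro y hy
    have : y ∈ Z.map (B'.mkQ ∘ₗ f) := hspan ▸ Submodule.subset_span hy
    exact this
  obtain ⟨t, htZ, ht, hts⟩ := (Set.exists_subset_image_finite_and (p := fun u => u = s)).1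
    ⟨s, hsub, hs, rfl⟩
  refine ⟨Submodule.span ℝ t ⊔ W₂, (Submodule.fg_span ht).sup hW₂, fun z hz => ?_⟩
  have hz' : (B'.mkQ ∘ₗ f) z ∈ (Submodule.span ℝ t).map (B'.mkQ ∘ₗ f) := by
    rw [Submodule.map_span, hts, hspan]
    exact Submodule.mem_map_of_mem hz
  obtain ⟨w, hw, hwz⟩ := hz'
  have hwZ : w ∈ Z := Submodule.span_le.2 htZ hw
  have hd : z - w ∈ Z ⊓ B'.comap f := by
    refine ⟨Z.sub_mem hz hwZ, ?_⟩
    rw [SetLike.mem_coe, Submodule.mem_comap, map_sub, ← Submodule.Quotient.eq]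
    exact hwz.symm
  rw [sup_assoc, ← add_sub_cancel w z]
  exact Submodule.add_mem_sup hw (hle₂ hd)

theorem FiniteModulo.finiteDimensional {Z B : Submodule ℝ M} (h : FiniteModulo Z B) :
    FiniteDimensional ℝ (Z ⧸ B.submoduleOf Z) := by
  obtain ⟨W, hW, hle⟩ := h
  have hfg : (Z.map B.mkQ).FG := by
    refine Submodule.FG.of_le (hW.map B.mkQ) ((Submodule.map_mono hle).trans ?_)
    simp [Submodule.map_sup]
  have : FiniteDimensional ℝ (Z.map B.mkQ) := Module.Finite.iff_fg.2 hfg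
  let g : (Z ⧸ B.submoduleOf Z) →ₗ[ℝ] (M ⧸ B) := (B.submoduleOf Z).mapQ B Z.subtype le_rfl
  have hg : Function.Injective g := by
    rw [← LinearMap.ker_eq_bot]
    exact Submodule.ker_liftQ_eq_bot _ _ _ (by simp [LinearMap.ker_comp, Submodule.submoduleOf])
  have hr : ∀ x, g x ∈ Z.map B.mkQ := by
    intro x
    obtain ⟨z, rfl⟩ := Submodule.mkQ_surjective _ x
    exact ⟨z, z.2, rfl⟩
  exact Module.Finite.of_injective (g.codRestrict _ hr) (by
    rwa [LinearMap.injective_codRestrict_iff])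

end LinearAlgebra

/-! ### The double complex argument -/

section DoubleComplex

variable {E : Type*} [NormedAddCommGroup E] [NormedSpace ℝ E] {C : PolyhedralComplex E}
  (Ω : Opens C.support)

/-- The `d''`-exact superforms of bidegree `(p, q)`. -/
noncomputable def dDoublePrimeExact (p : ℕ) : (q : ℕ) → Submodule ℝ (Form Ω p q)
  | 0 => ⊥
  | q + 1 => LinearMap.range (Form.dDoublePrime Ω p q)

/-- The `d''`-cohomology `H^{p,q}_{d''}(Ω)` is finite dimensional for all `p` and `q`. -/
def FiniteDDoublePrimeCohomology : Prop :=
  ∀ p q, FiniteModulo (LinearMap.ker (Form.dDoublePrime Ω p q)) (dDoublePrimeExact Ω p q)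

/-- The step `m` of the filtration by the first degree of the closed superforms of degree `k`:
the closed superforms with no component of bidegree `(p, q)` for `p < m`. -/
noncomputable def closedFiltration (k m : ℕ) : Submodule ℝ (TotalForm Ω k) :=
  LinearMap.ker (TotalForm.d Ω k) ⊓
    ⨅ (p : ℕ) (q : ℕ) (h : p + q = k) (_ : p < m), LinearMap.ker (TotalForm.component Ω k p q h)

theorem mem_closedFiltration {k m : ℕ} {a : TotalForm Ω k} :
    a ∈ closedFiltration Ω k m ↔ TotalForm.d Ω k a = 0 ∧
      ∀ p q h, p < m → TotalForm.component Ω k p q h a = 0 := by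
  simp [closedFiltration]

theorem component_d (k p q : ℕ) (h : p + q = k + 1) (a : TotalForm Ω k) :
    TotalForm.component Ω (k + 1) p q h (TotalForm.d Ω k a) = TotalForm.dComponent Ω k p q h a :=
  rfl

theorem dComponent_succ_of_component_eq_zero {k m q : ℕ} (h : m + (q + 1) = k + 1)
    {a : TotalForm Ω k} (ha : ∀ p q h, p < m → TotalForm.component Ω k p q h a = 0) :
    TotalForm.dComponent Ω k m (q + 1) h a =
      Form.dDoublePrime Ω m q (TotalForm.component Ω k m q (by omega) a) := by
  cases m with
  | zero => rfl
  | succ m => simp [TotalForm.dComponent, ha m (q + 1) (by omega) (by omega)]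

theorem dComponent_eq_zero_of_component_eq_zero {k m p q : ℕ} (h : p + q = k + 1) (hp : p < m)
    {a : TotalForm Ω k} (ha : ∀ p q h, p < m → TotalForm.component Ω k p q h a = 0) :
    TotalForm.dComponent Ω k p q h a = 0 := by
  match p, q, h with
  | 0, 0, h => exact absurd h (by omega)
  | p + 1, 0, h => simp [TotalForm.dComponent, ha p 0 (by omega) (by omega)]
  | 0, q + 1, h => simp [TotalForm.dComponent, ha 0 q (by omega) (by omega)]
  | p + 1, q + 1, h =>
    simp [TotalForm.dComponent, ha p (q + 1) (by omega) (by omega),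
      ha (p + 1) q (by omega) (by omega)]

/-- A closed superform whose lowest component is `d''b` agrees, up to the exact superform `db`,
with one that lies in the next step of the filtration. -/
theorem closedFiltration_inf_le {k m q : ℕ} (h : m + q = k) :
    closedFiltration Ω k m ⊓
        (dDoublePrimeExact Ω m q).comap (TotalForm.component Ω k m q h) ≤
      closedFiltration Ω k (m + 1) ⊔ exactForms Ω k := by
  rintro a ⟨ha, hex⟩
  obtain ⟨hd, ha⟩ := (mem_closedFiltration Ω).1 ha
  rw [SetLike.mem_coe, Submodule.mem_comap] at hex
  cases q with
  | zero =>
    refine Submodule.mem_sup_left ((mem_closedFiltration Ω).2 ⟨hd, fun p q' h' hp => ?_⟩)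
    rcases Nat.lt_succ_iff_lt_or_eq.1 hp with hp | rfl
    · exact ha p q' h' hp
    · obtain rfl : q' = 0 := by omega
      simpa [dDoublePrimeExact] using hex
  | succ q =>
    obtain ⟨k, rfl⟩ : ∃ k', k = k' + 1 := ⟨m + q, by omega⟩
    obtain ⟨b, hb⟩ := hex
    classical
    let i : {i : ℕ × ℕ // i.1 + i.2 = k} := ⟨(m, q), by simp; omega⟩
    let b' : TotalForm Ω k := Pi.single i b
    have hb' : TotalForm.component Ω k m q (by omega) b' = b :=
      Pi.single_eq_same (M := fun i : {i : ℕ × ℕ // i.1 + i.2 = k} => Form Ω i.1.1 i.1.2) i b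
    have hb0 : ∀ p q h, p < m → TotalForm.component Ω k p q h b' = 0 := by
      intro p q h hp
      refine Pi.single_eq_of_ne (i := i) (i' := ⟨(p, q), h⟩)
        (M := fun i : {i : ℕ × ℕ // i.1 + i.2 = k} => Form Ω i.1.1 i.1.2) ?_ b
      intro he
      have := congrArg (fun i => i.1.1) he
      simp [i] at this
      omega
    rw [← sub_add_cancel a (TotalForm.d Ω k b')]
    refine Submodule.add_mem_sup ((mem_closedFiltration Ω).2 ⟨?_, fun p q' h' hp => ?_⟩) ⟨b', rfl⟩
    · rw [map_sub, hd, TotalForm.d_comp_d, sub_zero]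
    · rw [map_sub, component_d, sub_eq_zero]
      rcases Nat.lt_succ_iff_lt_or_eq.1 hp with hp | rfl
      · rw [ha p q' h' hp, dComponent_eq_zero_of_component_eq_zero Ω h' hp hb0]
      · obtain rfl : q' = q + 1 := by omega
        rw [dComponent_succ_of_component_eq_zero Ω h' hb0, hb', hb]

/-- The double complex argument: finiteness of the `d''`-cohomology implies finiteness of the
cohomology of the total complex. -/
theorem FiniteDDoublePrimeCohomology.finiteModulo_d (hΩ : FiniteDDoublePrimeCohomology Ω) (k : ℕ) :
    FiniteModulo (LinearMap.ker (TotalForm.d Ω k)) (exactForms Ω k) := by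
  suffices H : ∀ j m, m + j = k + 1 → FiniteModulo (closedFiltration Ω k m) (exactForms Ω k) by
    refine (H (k + 1) 0 (by omega)).mono (fun a ha => ?_) le_rfl
    exact (mem_closedFiltration Ω).2 ⟨ha, fun p q h hp => absurd hp (by omega)⟩
  intro j
  induction j with
  | zero =>
    intro m hm
    refine finiteModulo_of_le fun a ha => ?_
    have : a = 0 := by
      funext i
      exact ((mem_closedFiltration Ω).1 ha).2 i.1.1 i.1.2 i.2 (by have := i.2; omega)
    rw [this]
    exact Submodule.zero_mem _
  | succ j ih =>
    intro m hm
    have h : m + j = k := by omega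
    refine FiniteModulo.of_map (TotalForm.component Ω k m j h)
      ((hΩ m j).mono ?_ le_rfl)
      ((ih (m + 1) (by omega)).sup.mono (closedFiltration_inf_le Ω h) le_rfl)
    rintro _ ⟨a, ha, rfl⟩
    obtain ⟨hd, ha⟩ := (mem_closedFiltration Ω).1 ha
    rw [LinearMap.mem_ker, ← dComponent_succ_of_component_eq_zero Ω (by omega) ha, ← component_d,
      hd, map_zero]

end DoubleComplex

/-! ### Restriction to smaller open sets -/

section Restriction

variable {E : Type*} [NormedAddCommGroup E] [NormedSpace ℝ E] {C : PolyhedralComplex E}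
  {Ω Ω' : Opens C.support} {p q : ℕ}

/-- Membership in `presentation` is a local condition. Smoothness is asked at all nearby points, since
`ContDiffAt ℝ ∞` at a point does not imply it on a neighbourhood. -/
theorem mem_presentation_iff {α : E → Cov E p q} :
    α ∈ presentation Ω p q ↔ ∀ x ∈ Ω, ∀ᶠ y in nhds (x : E), ContDiffAt ℝ ∞ α y := by
  constructor
  · rintro ⟨V, hV, hVΩ, h⟩ x hx
    have hxV : x ∈ ((↑) : C.support → E) ⁻¹' V := by rw [hVΩ]; exact hx
    filter_upwards [hV.mem_nhds hxV] with y hy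
    exact h.contDiffAt (hV.mem_nhds hy)
  · intro h
    obtain ⟨V, hV, hVΩ⟩ := isOpen_induced_iff.1 Ω.isOpen
    have hsub : interior {y | ContDiffAt ℝ ∞ α y} ⊆ {y | ContDiffAt ℝ ∞ α y} := interior_subset
    refine ⟨V ∩ interior {y | ContDiffAt ℝ ∞ α y}, hV.inter isOpen_interior, ?_, fun y hy =>
      ContDiffAt.contDiffWithinAt (hsub hy.2)⟩
    rw [Set.preimage_inter, hVΩ, Set.inter_eq_left]
    exact fun x hx => mem_interior_iff_mem_nhds.2 (h x hx)

theorem presentation_mono (h : Ω' ≤ Ω) : presentation Ω p q ≤ presentation Ω' p q :=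
  fun _ hα => mem_presentation_iff.2 fun x hx => mem_presentation_iff.1 hα x (h hx)

/-- The restriction `A^{p,q}(Ω) → A^{p,q}(Ω')` for `Ω' ⊆ Ω`: a superform and its restriction are
presented by the same function. -/
noncomputable def Form.res (h : Ω' ≤ Ω) (p q : ℕ) : Form Ω p q →ₗ[ℝ] Form Ω' p q :=
  (nullForms Ω p q).liftQ (Form.mk ∘ₗ Submodule.inclusion (presentation_mono h)) fun α hα => by
    rw [LinearMap.mem_ker, LinearMap.comp_apply, Form.mk_eq_zero_iff]
    exact fun σ hσ x hx => hα σ hσ x (h hx)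

theorem Form.mk_surjective : Function.Surjective (Form.mk : presentation Ω p q → Form Ω p q) :=
  Submodule.mkQ_surjective (nullForms Ω p q)

theorem Form.res_mk (h : Ω' ≤ Ω) (α : presentation Ω p q) :
    Form.res h p q (Form.mk α) = Form.mk ⟨α.1, presentation_mono h α.2⟩ := rfl

theorem Form.mk_eq_mk_iff (α β : presentation Ω p q) :
    Form.mk α = Form.mk β ↔ RestrictsToZero Ω (α.1 - β.1) := by
  rw [← sub_eq_zero, ← map_sub, Form.mk_eq_zero_iff]
  rfl

theorem Form.res_dDoublePrime (h : Ω' ≤ Ω) (a : Form Ω p q) :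
    Form.res h p (q + 1) (Form.dDoublePrime Ω p q a) =
      Form.dDoublePrime Ω' p q (Form.res h p q a) := by
  obtain ⟨α, rfl⟩ := Form.mk_surjective a
  rfl

end Restriction

/-! ### Cutoff functions and gluing -/

section Gluing

variable {E : Type*} [NormedAddCommGroup E] [NormedSpace ℝ E] {C : PolyhedralComplex E}
  {Ω₁ Ω₂ : Opens C.support} {p q : ℕ}

/-- A smooth partition of unity `ρ, 1 - ρ` for two open sets: `ρ` is defined on all of `E`, but only
its values on `V₁ ∪ V₂` matter. -/
theorem exists_cutoff [FiniteDimensional ℝ E] {V₁ V₂ : Set E} (h₁ : IsOpen V₁) (h₂ : IsOpen V₂) :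
    ∃ ρ : E → ℝ, ContDiffOn ℝ ∞ ρ (V₁ ∪ V₂) ∧ (∀ x ∈ V₁, x ∉ V₂ → ρ =ᶠ[nhds x] 1) ∧
      ∀ x ∈ V₂, x ∉ V₁ → ρ =ᶠ[nhds x] 0 := by
  obtain ⟨f₁, hs₁, hf₁, hr₁⟩ := h₁.exists_contDiff_support_eq (n := ⊤)
  obtain ⟨f₂, hs₂, hf₂, hr₂⟩ := h₂.exists_contDiff_support_eq (n := ⊤)
  have h0₁ : ∀ x, 0 ≤ f₁ x := fun x => (hr₁ ⟨x, rfl⟩).1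
  have h0₂ : ∀ x, 0 ≤ f₂ x := fun x => (hr₂ ⟨x, rfl⟩).1
  have hm₁ : ∀ x, x ∈ V₁ ↔ f₁ x ≠ 0 := fun x => by rw [← hs₁]; rfl
  have hm₂ : ∀ x, x ∈ V₂ ↔ f₂ x ≠ 0 := fun x => by rw [← hs₂]; rfl
  have hne : ∀ x ∈ V₁ ∪ V₂, f₁ x + f₂ x ≠ 0 := by
    intro x hx h
    rcases hx with hx | hx
    · exact (hm₁ x).1 hx (by linarith [h0₁ x, h0₂ x])
    · exact (hm₂ x).1 hx (by linarith [h0₁ x, h0₂ x])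
  -- The quotient `f₁ / (f₁ + f₂)` is `1` on `V₁ \ V₂` and `0` on `V₂ \ V₁`; the transition function
  -- makes it constant near these sets.
  set g : E → ℝ := fun x => 3 * (f₁ x / (f₁ x + f₂ x)) - 1 with hg
  have hgc : ContDiffOn ℝ ∞ g (V₁ ∪ V₂) :=
    (contDiffOn_const.mul (hf₁.contDiffOn.div (hf₁.add hf₂).contDiffOn hne)).sub contDiffOn_const
  have hga : ∀ x ∈ V₁ ∪ V₂, ContinuousAt g x := fun x hx =>
    hgc.continuousOn.continuousAt ((h₁.union h₂).mem_nhds hx)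
  refine ⟨fun x => Real.smoothTransition (g x),
    Real.smoothTransition.contDiff.comp_contDiffOn hgc, fun x hx hx' => ?_, fun x hx hx' => ?_⟩
  · have h2 : f₂ x = 0 := by simpa [hm₂] using hx'
    have hgx : 1 < g x := by
      simp only [hg, h2, add_zero, div_self ((hm₁ x).1 hx)]
      norm_num
    filter_upwards [(hga x (Or.inl hx)).eventually (lt_mem_nhds hgx)] with y hy
    exact Real.smoothTransition.one_of_one_le hy.le
  · have h1 : f₁ x = 0 := by simpa [hm₁] using hx'
    have hgx : g x < 0 := by simp [hg, h1]
    filter_upwards [(hga x (Or.inr hx)).eventually (gt_mem_nhds hgx)] with y hy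
    exact Real.smoothTransition.zero_of_nonpos hy.le

/-- The cutoff functions for two open subsets of the support. -/
theorem exists_cutoff_support [FiniteDimensional ℝ E] (Ω₁ Ω₂ : Opens C.support) :
    ∃ ρ : E → ℝ, (∀ x : C.support, x ∈ Ω₁ ∨ x ∈ Ω₂ → ∀ᶠ y in nhds (x : E), ContDiffAt ℝ ∞ ρ y) ∧
      (∀ x ∈ Ω₁, x ∉ Ω₂ → ρ =ᶠ[nhds (x : E)] 1) ∧ ∀ x ∈ Ω₂, x ∉ Ω₁ → ρ =ᶠ[nhds (x : E)] 0 := by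
  obtain ⟨V₁, hV₁, hVΩ₁⟩ := isOpen_induced_iff.1 Ω₁.isOpen
  obtain ⟨V₂, hV₂, hVΩ₂⟩ := isOpen_induced_iff.1 Ω₂.isOpen
  have hm₁ : ∀ x : C.support, x ∈ Ω₁ ↔ (x : E) ∈ V₁ := fun x => (Set.ext_iff.1 hVΩ₁ x).symm
  have hm₂ : ∀ x : C.support, x ∈ Ω₂ ↔ (x : E) ∈ V₂ := fun x => (Set.ext_iff.1 hVΩ₂ x).symm
  obtain ⟨ρ, hρ, hρ₁, hρ₂⟩ := exists_cutoff hV₁ hV₂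
  simp only [hm₁, hm₂]
  refine ⟨ρ, fun x hx => ?_, fun x => hρ₁ x, fun x => hρ₂ x⟩
  filter_upwards [(hV₁.union hV₂).mem_nhds hx] with y hy
  exact hρ.contDiffAt ((hV₁.union hV₂).mem_nhds hy)

/-- Superforms are determined by their restrictions to two open sets that cover. -/
theorem Form.eq_zero_of_res_eq_zero {a : Form (Ω₁ ⊔ Ω₂) p q}
    (h₁ : Form.res le_sup_left p q a = 0) (h₂ : Form.res le_sup_right p q a = 0) : a = 0 := by
  obtain ⟨α, rfl⟩ := Form.mk_surjective a
  rw [Form.res_mk, Form.mk_eq_zero_iff] at h₁ h₂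
  rw [Form.mk_eq_zero_iff]
  rintro σ hσ x (hx | hx)
  · exact h₁ σ hσ x hx
  · exact h₂ σ hσ x hx

/-- Superforms on two open sets that agree on the intersection glue: if they are presented by `α` and
`β`, then `ρ α + (1 - ρ) β` presents the glued superform. -/
theorem Form.exists_glue [FiniteDimensional ℝ E] (a : Form Ω₁ p q) (b : Form Ω₂ p q)
    (h : Form.res (Ω' := Ω₁ ⊓ Ω₂) inf_le_left p q a = Form.res inf_le_right p q b) :
    ∃ c : Form (Ω₁ ⊔ Ω₂) p q, Form.res le_sup_left p q c = a ∧ Form.res le_sup_right p q c = b := by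
  obtain ⟨⟨α, hα⟩, rfl⟩ := Form.mk_surjective a
  obtain ⟨⟨β, hβ⟩, rfl⟩ := Form.mk_surjective b
  rw [Form.res_mk, Form.res_mk, Form.mk_eq_mk_iff] at h
  obtain ⟨ρ, hρ, hρ₁, hρ₂⟩ := exists_cutoff_support Ω₁ Ω₂
  have hγ : (fun x => ρ x • α x + (1 - ρ x) • β x) ∈ presentation (Ω₁ ⊔ Ω₂) p q := by
    rw [mem_presentation_iff] at hα hβ ⊢
    intro x hx
    by_cases h1 : x ∈ Ω₁
    · by_cases h2 : x ∈ Ω₂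
      · filter_upwards [hρ x hx, hα x h1, hβ x h2] with y hy hy1 hy2
        exact (hy.smul hy1).add ((contDiffAt_const.sub hy).smul hy2)
      · filter_upwards [(hρ₁ x h1 h2).eventuallyEq_nhds, hα x h1] with y hy hy1
        refine hy1.congr_of_eventuallyEq ?_
        filter_upwards [hy] with z hz
        simp [hz]
    · have h2 : x ∈ Ω₂ := hx.resolve_left h1
      filter_upwards [(hρ₂ x h2 h1).eventuallyEq_nhds, hβ x h2] with y hy hy1
      refine hy1.congr_of_eventuallyEq ?_
      filter_upwards [hy] with z hz
      simp [hz]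
  refine ⟨Form.mk ⟨_, hγ⟩, ?_, ?_⟩
  · rw [Form.res_mk, Form.mk_eq_mk_iff]
    intro σ hσ x hx hxσ v hv w hw
    by_cases h2 : x ∈ Ω₂
    · have := h σ hσ x ⟨hx, h2⟩ hxσ v hv w hw
      simp only [Pi.sub_apply, ContinuousAlternatingMap.sub_apply] at this
      simp only [Pi.sub_apply, ContinuousAlternatingMap.sub_apply,
        ContinuousAlternatingMap.add_apply, ContinuousAlternatingMap.smul_apply, smul_eq_mul]
      linear_combination (ρ x - 1) * this
    · simp [(hρ₁ x hx h2).eq_of_nhds]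
  · rw [Form.res_mk, Form.mk_eq_mk_iff]
    intro σ hσ x hx hxσ v hv w hw
    by_cases h1 : x ∈ Ω₁
    · have := h σ hσ x ⟨h1, hx⟩ hxσ v hv w hw
      simp only [Pi.sub_apply, ContinuousAlternatingMap.sub_apply] at this
      simp only [Pi.sub_apply, ContinuousAlternatingMap.sub_apply,
        ContinuousAlternatingMap.add_apply, ContinuousAlternatingMap.smul_apply, smul_eq_mul]
      linear_combination ρ x * this
    · simp [(hρ₂ x hx h1).eq_of_nhds]

/-- Every superform on an intersection is a difference of restrictions: a cutoff function that vanishes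
near the points outside the intersection allows extension by zero. -/
theorem Form.exists_res_sub_res [FiniteDimensional ℝ E] (c : Form (Ω₁ ⊓ Ω₂) p q) :
    ∃ (a : Form Ω₁ p q) (b : Form Ω₂ p q),
      Form.res inf_le_left p q a - Form.res inf_le_right p q b = c := by
  obtain ⟨⟨γ, hγ⟩, rfl⟩ := Form.mk_surjective c
  obtain ⟨ρ, hρ, hρ₁, hρ₂⟩ := exists_cutoff_support Ω₁ Ω₂
  rw [mem_presentation_iff] at hγ
  have hα : (fun x => (1 - ρ x) • γ x) ∈ presentation Ω₁ p q := by
    rw [mem_presentation_iff]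
    intro x h1
    by_cases h2 : x ∈ Ω₂
    · filter_upwards [hρ x (Or.inl h1), hγ x ⟨h1, h2⟩] with y hy hy1
      exact (contDiffAt_const.sub hy).smul hy1
    · filter_upwards [(hρ₁ x h1 h2).eventuallyEq_nhds] with y hy
      refine (contDiffAt_const (c := (0 : Cov E p q))).congr_of_eventuallyEq ?_
      filter_upwards [hy] with z hz
      simp [hz]
  have hβ : (fun x => (-ρ x) • γ x) ∈ presentation Ω₂ p q := by
    rw [mem_presentation_iff]
    intro x h2
    by_cases h1 : x ∈ Ω₁
    · filter_upwards [hρ x (Or.inl h1), hγ x ⟨h1, h2⟩] with y hy hy1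
      exact hy.neg.smul hy1
    · filter_upwards [(hρ₂ x h2 h1).eventuallyEq_nhds] with y hy
      refine (contDiffAt_const (c := (0 : Cov E p q))).congr_of_eventuallyEq ?_
      filter_upwards [hy] with z hz
      simp [hz]
  refine ⟨Form.mk ⟨_, hα⟩, Form.mk ⟨_, hβ⟩, ?_⟩
  rw [Form.res_mk, Form.res_mk, ← map_sub, Form.mk_eq_mk_iff]
  intro σ hσ x hx hxσ v hv w hw
  have : (1 - ρ x) • γ x - (-ρ x) • γ x - γ x = 0 := by module
  change ((1 - ρ x) • γ x - (-ρ x) • γ x - γ x) v w = 0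
  rw [this]
  rfl

end Gluing

/-! ### Mayer–Vietoris for `d''` -/

section MayerVietoris

variable {E : Type*} [NormedAddCommGroup E] [NormedSpace ℝ E] {C : PolyhedralComplex E}
  {Ω₁ Ω₂ : Opens C.support}

variable (Ω₁ Ω₂) in
/-- The restriction of a superform on a union of two open sets to both of them. -/
noncomputable def Form.resProd (p q : ℕ) : Form (Ω₁ ⊔ Ω₂) p q →ₗ[ℝ] Form Ω₁ p q × Form Ω₂ p q :=
  (Form.res le_sup_left p q).prod (Form.res le_sup_right p q)

variable (Ω₁ Ω₂) in
/-- The difference on the intersection of superforms on two open sets. -/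
noncomputable def Form.resDiff (p q : ℕ) :
    Form Ω₁ p q × Form Ω₂ p q →ₗ[ℝ] Form (Ω₁ ⊓ Ω₂) p q :=
  (Form.res inf_le_left p q).coprod (-Form.res inf_le_right p q)

theorem Form.resDiff_apply (p q : ℕ) (x : Form Ω₁ p q × Form Ω₂ p q) :
    Form.resDiff Ω₁ Ω₂ p q x =
      Form.res inf_le_left p q x.1 - Form.res inf_le_right p q x.2 := by
  simp [Form.resDiff, sub_eq_add_neg]

theorem Form.resProd_injective (p q : ℕ) : Function.Injective (Form.resProd Ω₁ Ω₂ p q) := by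
  refine (injective_iff_map_eq_zero _).2 fun a ha => ?_
  exact Form.eq_zero_of_res_eq_zero (congrArg Prod.fst ha) (congrArg Prod.snd ha)

theorem Form.exists_resProd_eq [FiniteDimensional ℝ E] {p q : ℕ} {x : Form Ω₁ p q × Form Ω₂ p q}
    (hx : Form.resDiff Ω₁ Ω₂ p q x = 0) : ∃ a, Form.resProd Ω₁ Ω₂ p q a = x := by
  rw [Form.resDiff_apply, sub_eq_zero] at hx
  obtain ⟨c, h₁, h₂⟩ := Form.exists_glue x.1 x.2 hx
  exact ⟨c, Prod.ext h₁ h₂⟩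

variable (Ω₁ Ω₂) in
/-- The operator `d''` on pairs of superforms. -/
noncomputable def Form.dDoublePrimeProd (p q : ℕ) :
    Form Ω₁ p q × Form Ω₂ p q →ₗ[ℝ] Form Ω₁ p (q + 1) × Form Ω₂ p (q + 1) :=
  (Form.dDoublePrime Ω₁ p q).prodMap (Form.dDoublePrime Ω₂ p q)

theorem Form.resProd_dDoublePrime {p q : ℕ} (a : Form (Ω₁ ⊔ Ω₂) p q) :
    Form.resProd Ω₁ Ω₂ p (q + 1) (Form.dDoublePrime _ p q a) =
      Form.dDoublePrimeProd Ω₁ Ω₂ p q (Form.resProd Ω₁ Ω₂ p q a) :=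
  Prod.ext (Form.res_dDoublePrime _ a) (Form.res_dDoublePrime _ a)

theorem Form.resDiff_dDoublePrimeProd {p q : ℕ} (x : Form Ω₁ p q × Form Ω₂ p q) :
    Form.resDiff Ω₁ Ω₂ p (q + 1) (Form.dDoublePrimeProd Ω₁ Ω₂ p q x) =
      Form.dDoublePrime _ p q (Form.resDiff Ω₁ Ω₂ p q x) := by
  rw [Form.resDiff_apply, Form.resDiff_apply, map_sub]
  exact congrArg₂ _ (Form.res_dDoublePrime _ _) (Form.res_dDoublePrime _ _)

theorem Form.resDiff_resProd {p q : ℕ} (a : Form (Ω₁ ⊔ Ω₂) p q) :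
    Form.resDiff Ω₁ Ω₂ p q (Form.resProd Ω₁ Ω₂ p q a) = 0 := by
  obtain ⟨α, rfl⟩ := Form.mk_surjective a
  rw [Form.resDiff_apply, sub_eq_zero]
  rfl

/-- If the difference of two superforms is `d''`-exact on the intersection, then changing the two
superforms by `d''`-exact ones makes them glue. -/
theorem Form.exists_dDoublePrimeProd_eq [FiniteDimensional ℝ E] {p q : ℕ}
    {x : Form Ω₁ p q × Form Ω₂ p q}
    (hx : Form.resDiff Ω₁ Ω₂ p q x ∈ dDoublePrimeExact (Ω₁ ⊓ Ω₂) p q) :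
    ∃ a, Form.dDoublePrimeProd Ω₁ Ω₂ p q x =
      Form.resProd Ω₁ Ω₂ p (q + 1) (Form.dDoublePrime _ p q a) := by
  cases q with
  | zero =>
    obtain ⟨a, ha⟩ := Form.exists_resProd_eq (by simpa [dDoublePrimeExact] using hx)
    exact ⟨a, by rw [Form.resProd_dDoublePrime, ha]⟩
  | succ q =>
    obtain ⟨c, hc⟩ := hx
    obtain ⟨b₁, b₂, hb⟩ := Form.exists_res_sub_res c
    obtain ⟨a, ha⟩ := Form.exists_resProd_eq
      (x := x - Form.dDoublePrimeProd Ω₁ Ω₂ p q (b₁, b₂)) (by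
        rw [map_sub, Form.resDiff_dDoublePrimeProd, Form.resDiff_apply p q, hb, hc, sub_self])
    refine ⟨a, ?_⟩
    rw [Form.resProd_dDoublePrime, ha, map_sub]
    simp [Form.dDoublePrimeProd, Form.dDoublePrime_dDoublePrime]

/-- The Mayer–Vietoris argument. -/
theorem FiniteDDoublePrimeCohomology.sup [FiniteDimensional ℝ E]
    (h₁ : FiniteDDoublePrimeCohomology Ω₁) (h₂ : FiniteDDoublePrimeCohomology Ω₂)
    (h₁₂ : FiniteDDoublePrimeCohomology (Ω₁ ⊓ Ω₂)) : FiniteDDoublePrimeCohomology (Ω₁ ⊔ Ω₂) := by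
  intro p q
  refine FiniteModulo.of_map (Form.resProd Ω₁ Ω₂ p q) (((h₁ p q).prod (h₂ p q)).mono ?_ le_rfl) ?_
  · rintro _ ⟨a, ha, rfl⟩
    have := Form.resProd_dDoublePrime a
    rw [LinearMap.mem_ker.1 ha, map_zero] at this
    exact ⟨(congrArg Prod.fst this).symm, (congrArg Prod.snd this).symm⟩
  cases q with
  | zero =>
    refine finiteModulo_of_le ?_
    rintro a ⟨-, ha⟩
    have h0 : Form.resProd Ω₁ Ω₂ p 0 a = 0 := by
      simpa [dDoublePrimeExact, Prod.ext_iff] using ha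
    rw [(injective_iff_map_eq_zero _).1 (Form.resProd_injective p 0) a h0]
    exact Submodule.zero_mem _
  | succ q =>
    have hP : FiniteModulo
        (LinearMap.ker (Form.resDiff Ω₁ Ω₂ p (q + 1) ∘ₗ Form.dDoublePrimeProd Ω₁ Ω₂ p q))
        ((dDoublePrimeExact (Ω₁ ⊓ Ω₂) p q).comap (Form.resDiff Ω₁ Ω₂ p q)) := by
      refine FiniteModulo.of_map (Form.resDiff Ω₁ Ω₂ p q) ((h₁₂ p q).mono ?_ le_rfl)
        (finiteModulo_of_le inf_le_right)
      rintro _ ⟨x, hx, rfl⟩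
      rw [LinearMap.mem_ker, ← Form.resDiff_dDoublePrimeProd]
      exact hx
    -- Up to the finite dimensional `W`, a pair of superforms whose `d''` glue has exact difference
    -- on the intersection.
    obtain ⟨W, hW, hle⟩ := hP
    -- As `resProd` is injective, finiteness may be checked after applying it.
    refine FiniteModulo.of_map (Form.resProd Ω₁ Ω₂ p (q + 1))
      (B' := (dDoublePrimeExact (Ω₁ ⊔ Ω₂) p (q + 1)).map (Form.resProd Ω₁ Ω₂ p (q + 1)))
      ⟨W.map (Form.dDoublePrimeProd Ω₁ Ω₂ p q), hW.map _, ?_⟩ (finiteModulo_of_le ?_)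
    · rintro _ ⟨a, ⟨-, ⟨y₁, hy₁⟩, ⟨y₂, hy₂⟩⟩, rfl⟩
      have hy : Form.dDoublePrimeProd Ω₁ Ω₂ p q (y₁, y₂) = Form.resProd Ω₁ Ω₂ p (q + 1) a :=
        Prod.ext hy₁ hy₂
      have hmem : (y₁, y₂) ∈
          LinearMap.ker (Form.resDiff Ω₁ Ω₂ p (q + 1) ∘ₗ Form.dDoublePrimeProd Ω₁ Ω₂ p q) := by
        rw [LinearMap.mem_ker, LinearMap.comp_apply, hy, Form.resDiff_resProd]
      obtain ⟨w, hw, x, hx, hwx⟩ := Submodule.mem_sup.1 (hle hmem)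
      rw [← hy, ← hwx, map_add]
      refine Submodule.add_mem_sup ⟨w, hw, rfl⟩ ?_
      obtain ⟨b, hb⟩ := Form.exists_dDoublePrimeProd_eq hx
      exact ⟨_, ⟨b, rfl⟩, hb.symm⟩
    · rw [Submodule.comap_map_eq_of_injective (Form.resProd_injective p (q + 1))]
      exact inf_le_right

end MayerVietoris

/-! ### Open stars in a polyhedral complex -/

section Stars

variable {E : Type*} [NormedAddCommGroup E] [NormedSpace ℝ E]

theorem IsPolyhedron.isClosed {σ : Set E} (h : IsPolyhedron σ) : IsClosed σ := by
  obtain ⟨H, rfl⟩ := h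
  simp only [Set.ofPred_forall]
  exact isClosed_iInter fun h => isClosed_iInter fun _ =>
    isClosed_le h.1.continuous continuous_const

theorem IsPolyhedron.convex {σ : Set E} (h : IsPolyhedron σ) : Convex ℝ σ := by
  obtain ⟨H, rfl⟩ := h
  simp only [Set.ofPred_forall]
  exact convex_iInter fun h => convex_iInter fun _ =>
    convex_halfSpace_le h.1.toLinearMap.isLinear _

variable (C : PolyhedralComplex E)

/-- The open star of a point `x` of the support: the points all of whose cells contain `x`. It
depends only on the set of cells containing `x`, and contains `x` itself. -/
def PolyhedralComplex.openStar (x : C.support) : Opens C.support where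
  carrier := {y | ∀ τ ∈ C.cells, (y : E) ∈ τ → (x : E) ∈ τ}
  is_open' := by
    have : {y : C.support | ∀ τ ∈ C.cells, (y : E) ∈ τ → (x : E) ∈ τ} =
        (⋃ τ ∈ {τ ∈ C.cells | (x : E) ∉ τ}, ((↑) : C.support → E) ⁻¹' τ)ᶜ := by
      ext y
      simp only [Set.mem_ofPred_eq, Set.mem_compl_iff, Set.mem_iUnion, Set.mem_preimage, not_exists]
      exact ⟨fun h τ hτ hy => hτ.2 (h τ hτ.1 hy), fun h τ hτ hy => by_contra fun hx =>
        h τ ⟨hτ, hx⟩ hy⟩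
    rw [this, isOpen_compl_iff]
    exact (C.finite_cells.subset (Set.sep_subset _ _)).isClosed_biUnion fun τ hτ =>
      (C.isPolyhedron_of_mem τ hτ.1).isClosed.preimage continuous_subtype_val

variable {C}

theorem mem_openStar_self (x : C.support) : x ∈ C.openStar x := fun _ _ h => h

/-- Two cells meet in a common face, so a cell containing a point of an open segment in another cell
contains the segment's end point. -/
theorem left_mem_of_mem_openSegment {σ τ : Set E} (hσ : σ ∈ C.cells) (hτ : τ ∈ C.cells) {x y z : E}
    (hx : x ∈ σ) (hy : y ∈ σ) (hz : z ∈ openSegment ℝ x y) (hzτ : z ∈ τ) : x ∈ τ := by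
  have hzσ : z ∈ σ := (C.isPolyhedron_of_mem σ hσ).convex.openSegment_subset hx hy hz
  exact ((C.inter_isFace σ hσ τ hτ).1.isExtreme.left_mem_of_mem_openSegment hx hy
    ⟨hzσ, hzτ⟩ hz).2

/-- If two open stars meet, their intersection is the open star of the midpoint of their centres. -/
theorem openStar_inf_openStar (x x' : C.support) :
    C.openStar x ⊓ C.openStar x' = ⊥ ∨ ∃ z, C.openStar x ⊓ C.openStar x' = C.openStar z := by
  by_cases h : C.openStar x ⊓ C.openStar x' = ⊥
  · exact Or.inl h
  · obtain ⟨y, hy, hy'⟩ : ∃ y, y ∈ C.openStar x ⊓ C.openStar x' := by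
      by_contra hne
      push Not at hne
      exact h (le_bot_iff.1 fun y hy => (hne y hy).elim)
    obtain ⟨σ, hσ, hyσ⟩ := y.2
    have hx := hy σ hσ hyσ
    have hx' := hy' σ hσ hyσ
    have hm : midpoint ℝ (x : E) x' ∈ openSegment ℝ (x : E) x' := by
      refine ⟨1 / 2, 1 / 2, by norm_num, by norm_num, by norm_num, ?_⟩
      rw [midpoint_eq_smul_add, smul_add]
      norm_num
    have hmσ := (C.isPolyhedron_of_mem σ hσ).convex.openSegment_subset hx hx' hm
    refine Or.inr ⟨⟨_, σ, hσ, hmσ⟩, ?_⟩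
    ext u
    constructor
    · rintro ⟨hu, hu'⟩ τ hτ huτ
      exact (C.isPolyhedron_of_mem τ hτ).convex.openSegment_subset (hu τ hτ huτ) (hu' τ hτ huτ) hm
    · refine fun hu => ⟨fun τ hτ huτ => ?_, fun τ hτ huτ => ?_⟩
      · exact left_mem_of_mem_openSegment hσ hτ hx hx' hm (hu τ hτ huτ)
      · exact left_mem_of_mem_openSegment hσ hτ hx' hx (openSegment_symm ℝ (x : E) x' ▸ hm)
          (hu τ hτ huτ)

/-- There are only finitely many open stars, as an open star is determined by a set of cells. -/
theorem finite_range_openStar : (Set.range C.openStar).Finite := by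
  refine (C.finite_cells.finite_subsets.image fun S : Set (Set E) =>
    sSup {U | ∃ x, U = C.openStar x ∧ {τ ∈ C.cells | (x : E) ∈ τ} = S}).subset ?_
  rintro _ ⟨x, rfl⟩
  refine ⟨{τ ∈ C.cells | (x : E) ∈ τ}, Set.sep_subset _ _, ?_⟩
  refine le_antisymm (sSup_le ?_) (le_sSup ⟨x, rfl, rfl⟩)
  rintro _ ⟨x', rfl, hx'⟩ y hy τ hτ hyτ
  have : τ ∈ {τ ∈ C.cells | (x' : E) ∈ τ} := ⟨hτ, hy τ hτ hyτ⟩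
  exact (hx' ▸ this : τ ∈ {τ ∈ C.cells | (x : E) ∈ τ}).2

theorem segment_mem_of_mem_openStar {x y : C.support} (hy : y ∈ C.openStar x) {τ : Set E}
    (hτ : τ ∈ C.cells) (hyτ : (y : E) ∈ τ) {t : ℝ} (ht : t ∈ Set.Icc (0 : ℝ) 1) :
    (x : E) + t • ((y : E) - x) ∈ τ :=
  (C.isPolyhedron_of_mem τ hτ).convex.add_smul_sub_mem (hy τ hτ hyτ) hyτ ht

/-- Open stars are star-shaped about their centre. -/
theorem exists_mem_openStar_eq {x y : C.support} (hy : y ∈ C.openStar x) {t : ℝ}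
    (ht : t ∈ Set.Icc (0 : ℝ) 1) :
    ∃ z ∈ C.openStar x, (z : E) = (x : E) + t • ((y : E) - x) := by
  obtain ⟨σ, hσ, hyσ⟩ := y.2
  refine ⟨⟨_, σ, hσ, segment_mem_of_mem_openStar hy hσ hyσ ht⟩, fun τ hτ hz => ?_, rfl⟩
  rcases ht.1.eq_or_lt with rfl | h0
  · simpa using hz
  rcases ht.2.eq_or_lt with rfl | h1
  · exact hy τ hτ (by simpa using hz)
  refine left_mem_of_mem_openSegment hσ hτ (hy σ hσ hyσ) hyσ ?_ hz
  exact ⟨1 - t, t, by linarith, h0, by ring, by module⟩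

end Stars

/-! ### Induction over finite unions of open stars -/

section Induction

/-- A property of elements of a distributive lattice that satisfies the Mayer–Vietoris principle and
holds on a set closed under meets holds for all finite joins of elements of that set. -/
theorem prop_foldr_sup_of_mayerVietoris {L : Type*} [DistribLattice L] [OrderBot L] {P : L → Prop}
    (hsup : ∀ a b, P a → P b → P (a ⊓ b) → P (a ⊔ b)) {S : Set L} (hS : InfClosed S)
    (hbot : P ⊥) (hP : ∀ a ∈ S, P a) (l : List L) (hl : ∀ a ∈ l, a ∈ S) :
    P (l.foldr (· ⊔ ·) ⊥) := by
  have hinf : ∀ (a : L) (l : List L),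
      a ⊓ l.foldr (· ⊔ ·) ⊥ = (l.map (a ⊓ ·)).foldr (· ⊔ ·) ⊥ := by
    intro a l
    induction l with
    | nil => simp
    | cons b l ih => simp [inf_sup_left, ih]
  induction h : l.length generalizing l with
  | zero => rw [List.length_eq_zero_iff] at h; simpa [h]
  | succ n ih =>
    obtain ⟨a, l, rfl⟩ := List.exists_cons_of_length_eq_add_one h
    have ha : a ∈ S := hl a (by simp)
    have hl' : ∀ b ∈ l, b ∈ S := fun b hb => hl b (by simp [hb])
    have hn : l.length = n := by simpa using h
    refine hsup _ _ (hP a ha) (ih l hl' hn) ?_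
    rw [hinf]
    refine ih _ (fun c hc => ?_) (by simpa using hn)
    obtain ⟨b, hb, rfl⟩ := List.mem_map.1 hc
    exact hS ha (hl' b hb)

variable {E : Type*} [NormedAddCommGroup E] [NormedSpace ℝ E] {C : PolyhedralComplex E}

theorem finiteDDoublePrimeCohomology_bot :
    FiniteDDoublePrimeCohomology (⊥ : Opens C.support) := by
  intro p q
  refine finiteModulo_of_le fun a _ => ?_
  have : a = 0 := by
    obtain ⟨α, rfl⟩ := Form.mk_surjective a
    rw [Form.mk_eq_zero_iff]
    exact fun σ _ x hx => hx.elim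
  rw [this]
  exact Submodule.zero_mem _

/-- Finiteness of the `d''`-cohomology of the open stars implies that of the whole support. -/
theorem finiteDDoublePrimeCohomology_top [FiniteDimensional ℝ E]
    (h : ∀ x, FiniteDDoublePrimeCohomology (C.openStar x)) :
    FiniteDDoublePrimeCohomology (⊤ : Opens C.support) := by
  have hS : InfClosed (insert ⊥ (Set.range C.openStar)) := by
    rintro _ (rfl | ⟨x, rfl⟩) _ (rfl | ⟨x', rfl⟩)
    · simp
    · simp
    · simp
    · rcases openStar_inf_openStar x x' with h | ⟨z, h⟩
      · exact Or.inl h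
      · exact Or.inr ⟨z, h.symm⟩
  have hle : ∀ (l : List (Opens C.support)), ∀ U ∈ l, U ≤ l.foldr (· ⊔ ·) ⊥ := by
    intro l
    induction l with
    | nil => simp
    | cons a l ih =>
      intro U hU
      rcases List.mem_cons.1 hU with rfl | hU
      · exact le_sup_left
      · exact (ih U hU).trans le_sup_right
  have htop : finite_range_openStar.toFinset.toList.foldr (· ⊔ ·) ⊥ = (⊤ : Opens C.support) := by
    refine eq_top_iff.2 fun x _ => hle _ (C.openStar x) (by simp) (mem_openStar_self x)
  rw [← htop]
  refine prop_foldr_sup_of_mayerVietoris (P := FiniteDDoublePrimeCohomology)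
    (fun a b => FiniteDDoublePrimeCohomology.sup) hS finiteDDoublePrimeCohomology_bot ?_ _
    (fun U hU => Or.inr (by simpa using hU))
  rintro _ (rfl | ⟨x, rfl⟩)
  · exact finiteDDoublePrimeCohomology_bot
  · exact h x

end Induction

/-! ### Smoothness of parametric integrals -/

section ParametricIntegral

theorem continuousOn_slice {X H : Type*} [TopologicalSpace X] [TopologicalSpace H] {f : X × ℝ → H}
    {U : Set (X × ℝ)} {x : X} (hf : ContinuousOn f U) (hx : ∀ t ∈ Set.Icc (0 : ℝ) 1, (x, t) ∈ U) :
    ContinuousOn (fun t => f (x, t)) (Set.Icc 0 1) :=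
  hf.comp (by fun_prop) hx

universe u

variable {E G : Type u} [NormedAddCommGroup E] [NormedSpace ℝ E] [NormedAddCommGroup G]
  [NormedSpace ℝ G] {U : Set (E × ℝ)} {f : E × ℝ → G} {x : E}

/-- Differentiation under the integral sign for a function that is smooth near `{x} × [0, 1]`. -/
theorem hasFDerivAt_integral_of_contDiffOn (hU : IsOpen U) (hf : ContDiffOn ℝ ∞ f U)
    (hx : ∀ t ∈ Set.Icc (0 : ℝ) 1, (x, t) ∈ U) :
    HasFDerivAt (fun y => ∫ t in (0 : ℝ)..1, f (y, t))
      (∫ t in (0 : ℝ)..1, fderiv ℝ f (x, t) ∘L ContinuousLinearMap.inl ℝ E ℝ) x := by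
  set f' : E × ℝ → E →L[ℝ] G := fun z => fderiv ℝ f z ∘L ContinuousLinearMap.inl ℝ E ℝ with hf'
  have hc' : ContinuousOn f' U :=
    (hf.continuousOn_fderiv_of_isOpen hU (by simp)).clm_comp continuousOn_const
  obtain ⟨M, hM⟩ := isCompact_Icc.exists_bound_of_continuousOn (continuousOn_slice hc' hx)
  have hopen : IsOpen (U ∩ (fun z => ‖f' z‖) ⁻¹' Set.Iio (M + 1)) :=
    hc'.norm.isOpen_inter_preimage hU isOpen_Iio
  obtain ⟨s, w, hs, -, hxs, hw, hsw⟩ := generalized_tube_lemma (isCompact_singleton (x := x))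
    (isCompact_Icc (a := (0 : ℝ)) (b := 1)) hopen (by
      rintro ⟨y, t⟩ ⟨rfl, ht⟩
      exact ⟨hx t ht, (hM t ht).trans_lt (by simp)⟩)
  have hsmem : s ∈ nhds x := hs.mem_nhds (hxs rfl)
  have hmem : ∀ y ∈ s, ∀ t ∈ Set.Icc (0 : ℝ) 1, (y, t) ∈ U := fun y hy t ht =>
    (hsw ⟨hy, hw ht⟩).1
  have hsub : Set.uIoc (0 : ℝ) 1 ⊆ Set.Icc 0 1 := by
    rw [Set.uIoc_of_le zero_le_one]; exact Set.Ioc_subset_Icc_self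
  have hmeas : ∀ {H : Type u} [NormedAddCommGroup H] {g : ℝ → H}, ContinuousOn g (Set.Icc 0 1) →
      MeasureTheory.AEStronglyMeasurable g
        (MeasureTheory.volume.restrict (Set.uIoc (0 : ℝ) 1)) := fun hg =>
    (hg.mono hsub).aestronglyMeasurable measurableSet_uIoc
  refine intervalIntegral.hasFDerivAt_integral_of_dominated_of_fderiv_le (F' := fun y t => f' (y, t))
    (bound := fun _ => M + 1) hsmem ?_ ?_ ?_ ?_ intervalIntegrable_const ?_
  · filter_upwards [hsmem] with y hy
    exact hmeas (continuousOn_slice hf.continuousOn (hmem y hy))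
  · exact (continuousOn_slice hf.continuousOn hx).intervalIntegrable_of_Icc zero_le_one
  · exact hmeas (continuousOn_slice hc' hx)
  · exact Filter.Eventually.of_forall fun t ht y hy => (hsw ⟨hy, hw (hsub ht)⟩).2.le
  · refine Filter.Eventually.of_forall fun t ht y hy => ?_
    have hd : HasFDerivAt f (fderiv ℝ f (y, t)) (y, t) :=
      ((hf.contDiffAt (hU.mem_nhds (hmem y hy t (hsub ht)))).differentiableAt
        (by simp)).hasFDerivAt
    exact hd.comp y (hasFDerivAt_prodMk_left y t)

/-- Smoothness under the integral sign, by induction on the order: the derivative of the integral is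
an integral of the same kind, with values in `E →L[ℝ] G`. -/
theorem contDiffOn_integral {V : Set E} (hU : IsOpen U) (hV : IsOpen V)
    (hVU : ∀ x ∈ V, ∀ t ∈ Set.Icc (0 : ℝ) 1, (x, t) ∈ U) (hf : ContDiffOn ℝ ∞ f U) :
    ContDiffOn ℝ ∞ (fun y => ∫ t in (0 : ℝ)..1, f (y, t)) V := by
  refine contDiffOn_infty.2 fun n => ?_
  induction n generalizing G with
  | zero =>
    exact contDiffOn_zero.2 fun x hx =>
      (hasFDerivAt_integral_of_contDiffOn hU hf (hVU x hx)).continuousAt.continuousWithinAt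
  | succ n ih =>
    push_cast
    refine (contDiffOn_succ_iff_fderiv_of_isOpen hV).2 ⟨fun x hx =>
      (hasFDerivAt_integral_of_contDiffOn hU hf
        (hVU x hx)).differentiableAt.differentiableWithinAt, by simp, ?_⟩
    refine (ih (f := fun z => fderiv ℝ f z ∘L ContinuousLinearMap.inl ℝ E ℝ)
      ((hf.fderiv_of_isOpen hU (by simp)).clm_comp contDiffOn_const)).congr fun x hx => ?_
    exact (hasFDerivAt_integral_of_contDiffOn hU hf (hVU x hx)).fderiv

end ParametricIntegral

/-! ### The homotopy operator -/

section Homotopy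

variable {E : Type*} [NormedAddCommGroup E] [NormedSpace ℝ E] {p q : ℕ}

instance [FiniteDimensional ℝ E] {F : Type*} [NormedAddCommGroup F] [NormedSpace ℝ F]
    [FiniteDimensional ℝ F] (n : ℕ) : FiniteDimensional ℝ (E [⋀^Fin n]→L[ℝ] F) := by
  let g : (E [⋀^Fin n]→L[ℝ] F) →ₗ[ℝ] MultilinearMap ℝ (fun _ : Fin n => E) F :=
    { toFun := fun a => a.toContinuousMultilinearMap.toMultilinearMap
      map_add' := fun _ _ => rfl
      map_smul' := fun _ _ => rfl }
  refine Module.Finite.of_injective g fun a b h => ?_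
  ext v
  exact congrArg (fun m : MultilinearMap ℝ (fun _ : Fin n => E) F => m v) h

variable (E p q) in
/-- The contraction of the second factor with a vector:
`⟨contractSecond a ξ; v₁, …, v_p, w₁, …, w_q⟩ = ⟨a; v₁, …, v_p, ξ, w₁, …, w_q⟩`. -/
noncomputable def contractSecond : Cov E p (q + 1) →L[ℝ] E →L[ℝ] Cov E p q :=
  LinearMap.mkContinuous₂
    (LinearMap.mk₂ ℝ (fun (a : Cov E p (q + 1)) (ξ : E) =>
      ((ContinuousAlternatingMap.curryLeftLI (𝕜 := ℝ) (E := E) (F := ℝ)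
        (n := q)).toContinuousLinearMap.flip ξ).compContinuousAlternatingMap a)
      (fun a b ξ => by ext v w; simp) (fun c a ξ => by ext v w; simp)
      (fun a ξ η => by ext v w; simp) (fun c a ξ => by ext v w; simp))
    1 (fun a ξ => by
      refine (ContinuousLinearMap.norm_compContinuousAlternatingMap_le _ _).trans ?_
      rw [one_mul, mul_comm]
      gcongr
      refine (ContinuousLinearMap.le_opNorm _ _).trans ?_
      rw [ContinuousLinearMap.opNorm_flip]
      exact mul_le_of_le_one_left (norm_nonneg _) (LinearIsometry.norm_toContinuousLinearMap_le _))

theorem contractSecond_apply (a : Cov E p (q + 1)) (ξ : E) (v : Fin p → E) (w : Fin q → E) :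
    contractSecond E p q a ξ v w = a v (Fin.cons ξ w) := rfl

/-- Expansion of `altSecond` along the first of the vectors. -/
theorem altSecond_apply_cons (L : E →L[ℝ] Cov E p (q + 1)) (ξ : E) (v : Fin p → E)
    (w : Fin (q + 1) → E) :
    altSecond p (q + 1) L v (Fin.cons ξ w) =
      (-1 : ℝ) ^ p * (L ξ v w -
        ∑ j : Fin (q + 1), (-1) ^ (j : ℕ) * L (w j) v (Fin.cons ξ (j.removeNth w))) := by
  rw [altSecond_apply, Fin.sum_univ_succ, sub_eq_add_neg, ← Finset.sum_neg_distrib]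
  congr 2
  · simp
  · refine Finset.sum_congr rfl fun j _ => ?_
    have : j.succ.removeNth (Fin.cons ξ w : Fin (q + 2) → E) = Fin.cons ξ (j.removeNth w) := by
      funext i
      refine Fin.cases ?_ (fun i => ?_) i <;> simp [Fin.removeNth]
    rw [this]
    simp [pow_succ]

/-- The alternating sum that expresses antisymmetry: inserting `w j` in front of the other vectors
costs the sign `(-1) ^ j`. -/
theorem sum_cons_removeNth (a : E [⋀^Fin (q + 1)]→L[ℝ] ℝ) (w : Fin (q + 1) → E) :
    ∑ j : Fin (q + 1), (-1) ^ (j : ℕ) * a (Fin.cons (w j) (j.removeNth w)) = (q + 1) * a w := by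
  have h := congrArg (fun b : E [⋀^Fin (q + 1)]→L[ℝ] ℝ => b w)
    (ContinuousAlternatingMap.alternatizeUncurryFin_curryLeft a)
  simp only [ContinuousAlternatingMap.alternatizeUncurryFin_apply,
    ContinuousAlternatingMap.curryLeft_apply_apply, Matrix.vecCons] at h
  simpa using h

/-- The integrand of the homotopy operator that contracts along the segments from `x`. -/
noncomputable def homotopyIntegrand (x : E) (α : E → Cov E p (q + 1)) (z : E × ℝ) : Cov E p q :=
  z.2 ^ q • contractSecond E p q (α (x + z.2 • (z.1 - x))) (z.1 - x)

/-- The homotopy operator of the Poincaré lemma for `d''`: the second factor is contracted along the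
segments from `x`, the first factor is carried along as coefficients. -/
noncomputable def homotopyOp (x : E) (α : E → Cov E p (q + 1)) (y : E) : Cov E p q :=
  ∫ t in (0 : ℝ)..1, homotopyIntegrand x α (y, t)

variable {x y : E} {U : Set E}

theorem contDiffOn_homotopyIntegrand {α : E → Cov E p (q + 1)} (hα : ContDiffOn ℝ ∞ α U) :
    ContDiffOn ℝ ∞ (homotopyIntegrand x α) {z : E × ℝ | x + z.2 • (z.1 - x) ∈ U} := by
  have hh : ContDiff ℝ ∞ fun z : E × ℝ => x + z.2 • (z.1 - x) := by fun_prop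
  have h1 : ContDiffOn ℝ ∞ (fun z : E × ℝ => contractSecond E p q (α (x + z.2 • (z.1 - x))))
      {z : E × ℝ | x + z.2 • (z.1 - x) ∈ U} :=
    (contractSecond E p q).contDiff.comp_contDiffOn (hα.comp hh.contDiffOn fun _ hz => hz)
  exact (contDiff_snd.pow q).contDiffOn.smul
    (h1.clm_apply (contDiff_fst.sub contDiff_const).contDiffOn)

theorem isOpen_segment_preimage (hU : IsOpen U) :
    IsOpen {z : E × ℝ | x + z.2 • (z.1 - x) ∈ U} :=
  hU.preimage (by fun_prop)

theorem contDiffOn_homotopyOp (hU : IsOpen U) {α : E → Cov E p (q + 1)}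
    (hα : ContDiffOn ℝ ∞ α U) {V : Set E} (hV : IsOpen V)
    (hVU : ∀ y ∈ V, ∀ t ∈ Set.Icc (0 : ℝ) 1, x + t • (y - x) ∈ U) :
    ContDiffOn ℝ ∞ (homotopyOp x α) V :=
  contDiffOn_integral (isOpen_segment_preimage hU) hV hVU (contDiffOn_homotopyIntegrand hα)

theorem intervalIntegrable_homotopyIntegrand {α : E → Cov E p (q + 1)}
    (hα : ContDiffOn ℝ ∞ α U) (hy : ∀ t ∈ Set.Icc (0 : ℝ) 1, x + t • (y - x) ∈ U) :
    IntervalIntegrable (fun t => homotopyIntegrand x α (y, t)) MeasureTheory.volume 0 1 :=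
  (continuousOn_slice (contDiffOn_homotopyIntegrand hα).continuousOn hy).intervalIntegrable_of_Icc
    zero_le_one

/-- The evaluation of `Λ^p E* ⊗ Λ^q E*` on given vectors. -/
noncomputable def evalCLM (v : Fin p → E) (w : Fin q → E) : Cov E p q →L[ℝ] ℝ :=
  ContinuousAlternatingMap.apply ℝ E ℝ w ∘L
    ContinuousAlternatingMap.apply ℝ E (E [⋀^Fin q]→L[ℝ] ℝ) v

theorem evalCLM_apply (v : Fin p → E) (w : Fin q → E) (a : Cov E p q) :
    evalCLM v w a = a v w := rfl

theorem homotopyOp_apply {α : E → Cov E p (q + 1)}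
    (hα : ContDiffOn ℝ ∞ α U) (hy : ∀ t ∈ Set.Icc (0 : ℝ) 1, x + t • (y - x) ∈ U)
    (v : Fin p → E) (w : Fin q → E) :
    homotopyOp x α y v w =
      ∫ t in (0 : ℝ)..1, t ^ q * α (x + t • (y - x)) v (Fin.cons (y - x) w) :=
  ((evalCLM v w).intervalIntegral_comp_comm (intervalIntegrable_homotopyIntegrand hα hy)).symm

theorem fderiv_homotopyIntegrand_inl (hU : IsOpen U) {α : E → Cov E p (q + 1)}
    (hα : ContDiffOn ℝ ∞ α U) {t : ℝ} (hy : x + t • (y - x) ∈ U) (u : E) :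
    (fderiv ℝ (homotopyIntegrand x α) (y, t) ∘L ContinuousLinearMap.inl ℝ E ℝ) u =
      t ^ q • (contractSecond E p q (t • fderiv ℝ α (x + t • (y - x)) u) (y - x) +
        contractSecond E p q (α (x + t • (y - x))) u) := by
  have h1 : HasFDerivAt (fun y => homotopyIntegrand x α (y, t))
      (fderiv ℝ (homotopyIntegrand x α) (y, t) ∘L ContinuousLinearMap.inl ℝ E ℝ) y :=
    (((contDiffOn_homotopyIntegrand hα).contDiffAt
      ((isOpen_segment_preimage hU).mem_nhds hy)).differentiableAt
        (by simp)).hasFDerivAt.comp y (hasFDerivAt_prodMk_left y t)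
  have h2 : HasFDerivAt α (fderiv ℝ α (x + t • (y - x))) (x + t • (y - x)) :=
    ((hα.contDiffAt (hU.mem_nhds hy)).differentiableAt (by simp)).hasFDerivAt
  have h3 : HasFDerivAt (fun y : E => y - x) (ContinuousLinearMap.id ℝ E) y :=
    (hasFDerivAt_id y).sub_const x
  have h4 := (((contractSecond E p q).hasFDerivAt.comp y
    (h2.comp y ((h3.const_smul t).const_add x))).clm_apply h3).const_smul (t ^ q)
  rw [h1.unique h4]
  simp [add_comm]

theorem intervalIntegrable_map_fderiv_homotopyIntegrand (hU : IsOpen U) {α : E → Cov E p (q + 1)}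
    (hα : ContDiffOn ℝ ∞ α U) (hy : ∀ t ∈ Set.Icc (0 : ℝ) 1, x + t • (y - x) ∈ U)
    {F : Type*} [NormedAddCommGroup F] [NormedSpace ℝ F] (M : (E →L[ℝ] Cov E p q) →L[ℝ] F) :
    IntervalIntegrable (fun t => M (fderiv ℝ (homotopyIntegrand x α) (y, t) ∘L
      ContinuousLinearMap.inl ℝ E ℝ)) MeasureTheory.volume 0 1 := by
  refine ContinuousOn.intervalIntegrable_of_Icc zero_le_one (M.continuous.comp_continuousOn ?_)
  exact continuousOn_slice
    (f := fun z => fderiv ℝ (homotopyIntegrand x α) z ∘L ContinuousLinearMap.inl ℝ E ℝ)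
    (((contDiffOn_homotopyIntegrand hα).continuousOn_fderiv_of_isOpen
      (isOpen_segment_preimage hU) (by simp)).clm_comp continuousOn_const) hy

/-- Differentiation of `homotopyOp` under the integral sign. It is stated after applying an arbitrary
continuous linear functional `M`, so that `d''` of `homotopyOp` is covered too. -/
theorem map_fderiv_homotopyOp (hU : IsOpen U) {α : E → Cov E p (q + 1)}
    (hα : ContDiffOn ℝ ∞ α U) (hy : ∀ t ∈ Set.Icc (0 : ℝ) 1, x + t • (y - x) ∈ U)
    (M : (E →L[ℝ] Cov E p q) →L[ℝ] ℝ) :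
    M (fderiv ℝ (homotopyOp x α) y) = ∫ t in (0 : ℝ)..1,
      M (fderiv ℝ (homotopyIntegrand x α) (y, t) ∘L ContinuousLinearMap.inl ℝ E ℝ) := by
  refine Eq.trans (congrArg M ?_) (M.intervalIntegral_comp_comm
    (intervalIntegrable_map_fderiv_homotopyIntegrand hU hα hy
      (ContinuousLinearMap.id ℝ (E →L[ℝ] Cov E p q)))).symm
  exact (hasFDerivAt_integral_of_contDiffOn (isOpen_segment_preimage hU)
    (contDiffOn_homotopyIntegrand hα) hy).fderiv

theorem altSecond_fderiv_homotopyIntegrand (hU : IsOpen U) {α : E → Cov E p (q + 1)}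
    (hα : ContDiffOn ℝ ∞ α U) {t : ℝ} (hy : x + t • (y - x) ∈ U) (v : Fin p → E)
    (w : Fin (q + 1) → E) :
    altSecond p q (fderiv ℝ (homotopyIntegrand x α) (y, t) ∘L ContinuousLinearMap.inl ℝ E ℝ) v w =
      (-1 : ℝ) ^ p * (t ^ (q + 1) * (∑ j : Fin (q + 1), (-1) ^ (j : ℕ) *
        fderiv ℝ α (x + t • (y - x)) (w j) v (Fin.cons (y - x) (j.removeNth w))) +
        t ^ q * ((q + 1) * α (x + t • (y - x)) v w)) := by
  rw [altSecond_apply]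
  simp_rw [fderiv_homotopyIntegrand_inl hU hα hy]
  rw [← sum_cons_removeNth]
  congr 1
  rw [Finset.mul_sum, Finset.mul_sum, ← Finset.sum_add_distrib]
  refine Finset.sum_congr rfl fun j _ => ?_
  simp only [ContinuousAlternatingMap.smul_apply, ContinuousAlternatingMap.add_apply,
    contractSecond_apply, smul_eq_mul, map_smul, smul_apply]
  ring

theorem contDiffOn_dDoublePrimeFun (hU : IsOpen U) {α : E → Cov E p q}
    (hα : ContDiffOn ℝ ∞ α U) : ContDiffOn ℝ ∞ (dDoublePrimeFun α) U := by
  have h (Φ : (E →L[ℝ] Cov E p q) →L[ℝ] Cov E p (q + 1)) :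
      ContDiffOn ℝ ∞ (fun y => Φ (fderiv ℝ α y)) U :=
    Φ.contDiff.comp_contDiffOn (hα.fderiv_of_isOpen hU (m := ∞) (by simp))
  exact h _

theorem hasDerivAt_apply_segment {α : E → Cov E p q} {t : ℝ}
    (hα : DifferentiableAt ℝ α (x + t • (y - x))) (v : Fin p → E) (w : Fin q → E) :
    HasDerivAt (fun t : ℝ => α (x + t • (y - x)) v w)
      (fderiv ℝ α (x + t • (y - x)) (y - x) v w) t := by
  have hline : HasDerivAt (fun t : ℝ => x + t • (y - x)) (y - x) t := by
    simpa using ((hasDerivAt_id t).smul_const (y - x)).const_add x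
  exact (evalCLM v w).hasFDerivAt.comp_hasDerivAt t (hα.hasFDerivAt.comp_hasDerivAt t hline)

/-- The homotopy formula. The sign `(-1) ^ p` is the one in the definition of `d''`. -/
theorem dDoublePrimeFun_homotopyOp (hU : IsOpen U) {α : E → Cov E p (q + 1)}
    (hα : ContDiffOn ℝ ∞ α U) (hy : ∀ t ∈ Set.Icc (0 : ℝ) 1, x + t • (y - x) ∈ U)
    (v : Fin p → E) (w : Fin (q + 1) → E) :
    dDoublePrimeFun (homotopyOp x α) y v w + homotopyOp x (dDoublePrimeFun α) y v w =
      (-1 : ℝ) ^ p * α y v w := by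
  have hdα := contDiffOn_dDoublePrimeFun hU hα
  have hi₁ := intervalIntegrable_map_fderiv_homotopyIntegrand hU hα hy
    (evalCLM v w ∘L altSecond p q)
  have hint₂ := intervalIntegrable_homotopyIntegrand hdα hy
  have hi₂ : IntervalIntegrable (fun t => t ^ (q + 1) *
      dDoublePrimeFun α (x + t • (y - x)) v (Fin.cons (y - x) w)) MeasureTheory.volume 0 1 :=
    ⟨(evalCLM v w).integrable_comp hint₂.1, (evalCLM v w).integrable_comp hint₂.2⟩
  have hd : dDoublePrimeFun (homotopyOp x α) y v w = _ :=
    map_fderiv_homotopyOp hU hα hy (evalCLM v w ∘L altSecond p q)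
  rw [hd, homotopyOp_apply hdα hy, ← intervalIntegral.integral_add hi₁ hi₂]
  -- The sum of the two integrands is the derivative of `(-1) ^ p * t ^ (q + 1) * α (x + t (y - x))`.
  rw [intervalIntegral.integral_eq_sub_of_hasDerivAt
    (f := fun t : ℝ => (-1 : ℝ) ^ p * (t ^ (q + 1) * α (x + t • (y - x)) v w)) ?_
    (hi₁.add hi₂)]
  · simp
  intro t ht
  rw [Set.uIcc_of_le zero_le_one] at ht
  have h3 := hasDerivAt_apply_segment
    ((hα.contDiffAt (hU.mem_nhds (hy t ht))).differentiableAt (by simp)) v w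
  refine (((hasDerivAt_pow (q + 1) t).mul h3).const_mul ((-1 : ℝ) ^ p)).congr_deriv ?_
  rw [ContinuousLinearMap.comp_apply, evalCLM_apply,
    altSecond_fderiv_homotopyIntegrand hU hα (hy t ht), dDoublePrimeFun, altSecond_apply_cons]
  push_cast
  ring

end Homotopy

/-! ### The Poincaré lemma for `d''` on open stars -/

section PoincareLemma

variable {E : Type*} [NormedAddCommGroup E] [NormedSpace ℝ E] {C : PolyhedralComplex E} {p q : ℕ}

/-- Vectors along a segment from the centre of an open star are tangent to all cells
that contain its end point. -/
theorem sub_mem_vectorSpan {x y : C.support} (hy : y ∈ C.openStar x) {τ : Set E}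
    (hτ : τ ∈ C.cells) (hyτ : (y : E) ∈ τ) : (y : E) - x ∈ vectorSpan ℝ τ :=
  vsub_mem_vectorSpan ℝ hyτ (hy τ hτ hyτ)

/-- A `d''`-closed superform of bidegree `(p, 0)` on an open star is constant. -/
theorem restrictsToZero_sub_const (x : C.support) {α : E → Cov E p 0}
    (hα : α ∈ presentation (C.openStar x) p 0)
    (h : RestrictsToZero (C.openStar x) (dDoublePrimeFun α)) :
    RestrictsToZero (C.openStar x) (α - fun _ => α x) := by
  intro τ hτ y hy hyτ v hv w hw
  have hderiv : ∀ t ∈ Set.uIcc (0 : ℝ) 1,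
      HasDerivAt (fun t : ℝ => α (x + t • ((y : E) - x)) v w) 0 t := by
    intro t ht
    rw [Set.uIcc_of_le zero_le_one] at ht
    obtain ⟨z, hz, hzt⟩ := exists_mem_openStar_eq hy ht
    refine (hasDerivAt_apply_segment
      (hzt ▸ (presentation_contDiffAt hα hz).differentiableAt (by simp)) v w).congr_deriv ?_
    have h0 := h τ hτ z hz (hzt ▸ segment_mem_of_mem_openStar hy hτ hyτ ht) v hv
      (fun _ => (y : E) - x) fun _ => sub_mem_vectorSpan hy hτ hyτ
    rw [dDoublePrimeFun, altSecond_apply, hzt] at h0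
    have hw0 : (0 : Fin 1).removeNth (fun _ : Fin 1 => (y : E) - x) = w := Subsingleton.elim _ _
    simpa [hw0] using h0
  have := intervalIntegral.integral_eq_sub_of_hasDerivAt hderiv intervalIntegrable_const
  simpa using this.symm

/-- The homotopy operator maps superforms on an open star to superforms on it. -/
theorem homotopyOp_mem_presentation (x : C.support) {α : E → Cov E p (q + 1)}
    (hα : α ∈ presentation (C.openStar x) p (q + 1)) :
    homotopyOp (x : E) α ∈ presentation (C.openStar x) p q := by
  obtain ⟨U, hU, hUΩ, h⟩ := hα
  have hm : ∀ z : C.support, (z : E) ∈ U ↔ z ∈ C.openStar x := fun z => Set.ext_iff.1 hUΩ z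
  rw [mem_presentation_iff]
  intro y hy
  obtain ⟨V, w, hV, -, hyV, hw, hVw⟩ := generalized_tube_lemma (isCompact_singleton (x := (y : E)))
    (isCompact_Icc (a := (0 : ℝ)) (b := 1)) (isOpen_segment_preimage (x := (x : E)) hU) (by
      rintro ⟨_, t⟩ ⟨rfl, ht⟩
      obtain ⟨z, hz, hzt⟩ := exists_mem_openStar_eq hy ht
      change (x : E) + t • ((y : E) - x) ∈ U
      exact hzt ▸ (hm z).2 hz)
  have hVU : ∀ u ∈ V, ∀ t ∈ Set.Icc (0 : ℝ) 1, (x : E) + t • (u - x) ∈ U :=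
    fun u hu t ht => hVw (Set.mk_mem_prod hu (hw ht))
  filter_upwards [hV.mem_nhds (hyV rfl)] with u hu
  exact (contDiffOn_homotopyOp hU h hV hVU).contDiffAt
    (hV.mem_nhds hu)

/-- The homotopy operator respects the restriction to cells: for `y` in a cell, the segment from the
centre to `y` lies in the cell, and its direction is tangent to the cell. -/
theorem restrictsToZero_homotopyOp (x : C.support) {α : E → Cov E p (q + 1)}
    (hα : α ∈ presentation (C.openStar x) p (q + 1))
    (h : RestrictsToZero (C.openStar x) α) :
    RestrictsToZero (C.openStar x) (homotopyOp (x : E) α) := by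
  obtain ⟨U, hU, hUΩ, hαU⟩ := hα
  have hm : ∀ z : C.support, (z : E) ∈ U ↔ z ∈ C.openStar x := fun z => Set.ext_iff.1 hUΩ z
  intro τ hτ y hy hyτ v hv w hw
  rw [homotopyOp_apply hαU (fun t ht => by
    obtain ⟨z, hz, hzt⟩ := exists_mem_openStar_eq hy ht
    exact hzt ▸ (hm z).2 hz), intervalIntegral.integral_congr (g := fun _ => (0 : ℝ)), intervalIntegral.integral_zero]
  intro t ht
  rw [Set.uIcc_of_le zero_le_one] at ht
  obtain ⟨z, hz, hzt⟩ := exists_mem_openStar_eq hy ht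
  have := h τ hτ z hz (hzt ▸ segment_mem_of_mem_openStar hy hτ hyτ ht) v hv
    (Fin.cons ((y : E) - x) w)
    (Fin.cases (sub_mem_vectorSpan hy hτ hyτ) hw)
  simp [← hzt, this]

/-- The Poincaré lemma: on an open star, the `d''`-cohomology is that of the constant superforms of
bidegree `(p, 0)`. -/
theorem finiteDDoublePrimeCohomology_openStar [FiniteDimensional ℝ E] (x : C.support) :
    FiniteDDoublePrimeCohomology (C.openStar x) := by
  intro p q
  cases q with
  | zero =>
    let c : Cov E p 0 →ₗ[ℝ] Form (C.openStar x) p 0 := Form.mk ∘ₗ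
      { toFun := fun a => ⟨fun _ => a, mem_presentation_iff.2 fun _ _ =>
          Filter.Eventually.of_forall fun _ => contDiffAt_const⟩
        map_add' := fun _ _ => rfl
        map_smul' := fun _ _ => rfl }
    refine ⟨LinearMap.range c, Module.Finite.iff_fg.1 inferInstance, fun a ha => ?_⟩
    obtain ⟨⟨α, hα⟩, rfl⟩ := Form.mk_surjective a
    rw [LinearMap.mem_ker, Form.dDoublePrime_mk, Form.mk_eq_zero_iff] at ha
    refine Submodule.mem_sup_left ⟨α x, ((Form.mk_eq_mk_iff _ _).2 ?_).symm⟩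
    exact restrictsToZero_sub_const x hα ha
  | succ q =>
    refine finiteModulo_of_le fun a ha => ?_
    obtain ⟨⟨α, hα⟩, rfl⟩ := Form.mk_surjective a
    rw [LinearMap.mem_ker, Form.dDoublePrime_mk, Form.mk_eq_zero_iff] at ha
    have hK := restrictsToZero_homotopyOp x (op_mem_presentation _ _ hα) ha
    refine ⟨(-1 : ℝ) ^ p • Form.mk ⟨_, homotopyOp_mem_presentation x hα⟩, ?_⟩
    rw [map_smul, Form.dDoublePrime_mk, ← map_smul, Form.mk_eq_mk_iff]
    obtain ⟨U, hU, hUΩ, hαU⟩ := hα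
    have hm : ∀ z : C.support, (z : E) ∈ U ↔ z ∈ C.openStar x := fun z => Set.ext_iff.1 hUΩ z
    intro τ hτ y hy hyτ v hv w hw
    have hf := dDoublePrimeFun_homotopyOp (x := (x : E)) (y := (y : E)) hU hαU (fun t ht => by
      obtain ⟨z, hz, hzt⟩ := exists_mem_openStar_eq hy ht
      exact hzt ▸ (hm z).2 hz) v w
    have h0 : homotopyOp (x : E) (dDoublePrimeFun α) y v w = 0 := hK τ hτ y hy hyτ v hv w hw
    rw [h0, add_zero] at hf
    change (-1 : ℝ) ^ p * dDoublePrimeFun (homotopyOp (x : E) α) y v w - α y v w = 0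
    rw [hf, ← mul_assoc, ← mul_pow]
    simp

end PoincareLemma

end Superform

theorem theorem3p13 (r : ℕ) (C : Superform.PolyhedralComplex (EuclideanSpace ℝ (Fin r))) (k : ℕ) :
    FiniteDimensional ℝ
      (Superform.DCohomology (⊤ : TopologicalSpace.Opens C.support) k) :=
  ((Superform.finiteDDoublePrimeCohomology_top
    Superform.finiteDDoublePrimeCohomology_openStar).finiteModulo_d _ k).finiteDimensional
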